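/- Let $p\ge 0$ be a fixed integer and let $A:(0,1]\to\mathbb R^{p\times p}$ be a matrix-valued function whose entries are Lipschitz on $(0,1)$. Write $A^2(u)=A(u)A(u)'$ and $$M(u)=A^2(u)-\int_0^1A^2(v)\,dv .$$ For a $p\times p$ symmetric matrix $M$, the pseudo nullity $d(M)$ is the largest integer $d\ge 0$ for which there is a $p\times d$ matrix $C$ with $C'C=I_d$ and $C'MC=0$. Let $Y_t=(Y_{1,t},\dots,Y_{p,t})'$, $t\ge 1$, be random vectors whose entries $Y_{i,t}$ are all independent and identically distributed with mean $0$, variance $1$, finite fourth moment and $\mu_4=\mathbb E(Y_{i,t}^2-1)^2>0$ ($\mu_4$ is treated as known). For each sample size $T$, observe $X_t=A(t/T)Y_t$, $t=1,\dots,T$. Let $K:\mathbb R\to\mathbb R$ be a kernel, that is, $K$ is symmetric ($K(-v)=K(v)$) and integrable with $\int_{\mathbb R} K(v)\,dv=1$, and suppose that $K$ is of bounded variation on $\mathbb R$ and $\int_{\mathbb R} |v||K(v)|\,dv<\infty$. Let $h=h_T>0$ be bandwidths with $h\to0$, $Th\to\infty$ and $Th^3\to0$ as $T\to\infty$. Fix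 $u\in(0,1)$ such that $A(u)$ is invertible. Put $\|K\|_2^2=\int_{\mathbb R} K(v)^2dv$, $K_h(v)=h^{-1}K(h^{-1}v)$, $$\widehat A^2(u)=\frac1T\sum_{t=1}^TX_tX_t'K_h\Big(u-\frac tT\Big),\qquad \widehat M(u)=\widehat A^2(u)-\frac1T\sum_{t=1}^TX_tX_t',\qquad \widehat F(u)=\widehat A(u)^{-1},$$ where $\widehat A(u)$ is the symmetric square root of $\widehat A^2(u)$. (With probability tending to one $\widehat A^2(u)$ is positive definite; otherwise, negative eigenvalues are replaced by $0$ in the square root, and $\widehat F(u)$ is set to $0$ if $\widehat A(u)$ is singular.) Let $\widehat\gamma_1(u)\le\dots\le\widehat\gamma_p(u)$ and $\widehat\gamma_{2,1}(u)\le\dots\le\widehat\gamma_{2,p}(u)$ be the ordered eigenvalues of $\widehat F(u)\widehat M(u)\widehat F(u)'$ and of $(\widehat F(u)\widehat M(u)\widehat F(u)')^2$, and define $$\widehat\xi_r(u)=\frac{Th}{\|K\|_2^2\,\mu_4}\sum_{i=1}^r\widehat\gamma_{2,i}(u),\qquad r=0,\dots,p.$$ Let $\alpha_T\in(0,1)$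 be significance levels. For $r=p,p-1,\dots$ in turn, reject the hypothesis $H_0:d_0(u)=r$ (that $M(u)$ has exactly $r$ zero eigenvalues) if $\widehat\xi_r(u)$ exceeds the $(1-\alpha_T)$-quantile of the $\chi^2(r(r+1)/2)$ law, until a hypothesis is not rejected; let $\widehat d_0(u)$ be the first $r$ that is not rejected ($\widehat d_0(u)=0$ if all hypotheses with $r\ge1$ are rejected). Define $$\widehat d_\pm(u)=\#\{i:\ \widehat\gamma_i(u)\gtrless0,\ \widehat\gamma_i(u)^2=\widehat\gamma_{2,k}(u)\text{ for some }k=\widehat d_0(u)+1,\dots,p\},$$ $$\widehat d(M(u))=\widehat d_0(u)+\min\big(\widehat d_+(u),\widehat d_-(u)\big).$$ Theorem. If $\alpha_T\to0$ and $(-\log\alpha_T)/(Th)\to0$ as $T\to\infty$, then $\widehat d(M(u))\to d(M(u))$ in probability. -/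

import Mathlib

open MeasureTheory ProbabilityTheory Filter Matrix
open scoped Topology

noncomputable section

namespace VCModel

/-! ### Pseudo nullity -/

/-- The pseudo nullity of a `p × p` matrix `M`: the largest `d` for which there is a `p × d` matrix
`C` with orthonormal columns and `Cᵀ M C = 0` (it is `0` if only `d = 0` is possible). -/
def pseudoNullity {p : ℕ} (M : Matrix (Fin p) (Fin p) ℝ) : ℕ :=
  sSup {d : ℕ | ∃ C : Matrix (Fin p) (Fin d) ℝ, Cᵀ * C = 1 ∧ Cᵀ * M * C = 0}

/-- The supremum defining the pseudo nullity is a maximum. -/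
theorem pseudoNullity_isGreatest {p : ℕ} (M : Matrix (Fin p) (Fin p) ℝ) :
    IsGreatest {d : ℕ | ∃ C : Matrix (Fin p) (Fin d) ℝ, Cᵀ * C = 1 ∧ Cᵀ * M * C = 0}
      (pseudoNullity M) := by
  have hb : BddAbove {d : ℕ | ∃ C : Matrix (Fin p) (Fin d) ℝ, Cᵀ * C = 1 ∧ Cᵀ * M * C = 0} := by
    refine ⟨p, ?_⟩
    rintro d ⟨C, hC, -⟩
    have h1 : (Cᵀ * C).rank = d := by rw [hC, Matrix.rank_one, Fintype.card_fin]
    have h2 : (Cᵀ * C).rank ≤ C.rank := Matrix.rank_mul_le_right _ _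
    have h3 : C.rank ≤ p := by simpa using Matrix.rank_le_card_height C
    omega
  have hne : {d : ℕ | ∃ C : Matrix (Fin p) (Fin d) ℝ,
      Cᵀ * C = 1 ∧ Cᵀ * M * C = 0}.Nonempty :=
    ⟨0, 0, Subsingleton.elim _ _, Subsingleton.elim _ _⟩
  exact ⟨Nat.sSup_mem hne hb, fun d hd => le_csSup hb hd⟩

/-! ### The varying covariance model -/

/-- `M(u) = A(u)A(u)' - ∫₀¹ A(v)A(v)' dv` (the integral is taken entrywise). -/
def popM {p : ℕ} (A : ℝ → Matrix (Fin p) (Fin p) ℝ) (u : ℝ) : Matrix (Fin p) (Fin p) ℝ :=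
  A u * (A u)ᵀ - Matrix.of fun i j => ∫ v in Set.Ioo (0 : ℝ) 1, (A v * (A v)ᵀ) i j

/-- The observation `X_t = A(t/T) Y_t` of the sample of size `T`. -/
def obs {p : ℕ} {Ω : Type*} (A : ℝ → Matrix (Fin p) (Fin p) ℝ) (Y : ℕ → Fin p → Ω → ℝ)
    (T : ℕ) (ω : Ω) (t : ℕ) : Fin p → ℝ :=
  A ((t : ℝ) / T) *ᵥ fun i => Y t i ω

/-- The entries of the `Y_t` are independent (over time and over coordinates) with the common
law `ν`, which has mean zero, unit variance and a finite fourth moment. -/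
structure IsIIDNoise {p : ℕ} {Ω : Type*} [MeasurableSpace Ω] (P : Measure Ω) (ν : Measure ℝ)
    (Y : ℕ → Fin p → Ω → ℝ) : Prop where
  indep : iIndepFun (fun q : ℕ × Fin p => Y q.1 q.2) P
  law : ∀ t i, HasLaw (Y t i) ν P
  fourth_moment : Integrable (fun x : ℝ => x ^ 4) ν
  mean_zero : ∫ x, x ∂ν = 0
  unit_variance : ∫ x, x ^ 2 ∂ν = 1

/-- `μ₄ = E (Y² - 1)²` for `Y` with law `ν`. -/
def mu4 (ν : Measure ℝ) : ℝ := ∫ x, (x ^ 2 - 1) ^ 2 ∂ν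

/-- Kernel functions: symmetric, integrating to one, with the regularity used in estimation at a
Lipschitz rate, namely bounded variation on the line and a finite first absolute moment. -/
structure IsKernel (K : ℝ → ℝ) : Prop where
  even : ∀ v, K (-v) = K v
  integrable : Integrable K
  integral_eq_one : ∫ v, K v = 1
  boundedVariation : BoundedVariationOn K Set.univ
  first_moment : Integrable (fun v => v * K v)

/-! ### Estimators, as functions of the sample `x 1, …, x T` -/

/-- The weighted sample covariance `T⁻¹ ∑_{t=1}^T w(t) x_t x_t'`. -/
def weightedCov {p : ℕ} (w : ℕ → ℝ) (T : ℕ) (x : ℕ → Fin p → ℝ) : Matrix (Fin p) (Fin p) ℝ :=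
  (T : ℝ)⁻¹ • ∑ t ∈ Finset.Icc 1 T, w t • Matrix.vecMulVec (x t) (x t)

/-- The kernel estimator of `A(u)A(u)'`, with weights `K_h(u - t/T) = h⁻¹ K(h⁻¹ (u - t/T))`. -/
def estA2 {p : ℕ} (K : ℝ → ℝ) (h u : ℝ) (T : ℕ) (x : ℕ → Fin p → ℝ) :
    Matrix (Fin p) (Fin p) ℝ :=
  weightedCov (fun t => h⁻¹ * K (h⁻¹ * (u - (t : ℝ) / T))) T x

/-- The estimator of `M(u)`. -/
def estM {p : ℕ} (K : ℝ → ℝ) (h u : ℝ) (T : ℕ) (x : ℕ → Fin p → ℝ) :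
    Matrix (Fin p) (Fin p) ℝ :=
  estA2 K h u T x - weightedCov (fun _ => 1) T x

/-- The inverse of the symmetric positive semidefinite square root of the estimator of `A(u)A(u)'`.
(The eigenvalues below would be the same for every other matrix root `R` with `R R'` equal to that
estimator, as long as the latter is positive definite.) -/
def estF {p : ℕ} (K : ℝ → ℝ) (h u : ℝ) (T : ℕ) (x : ℕ → Fin p → ℝ) :
    Matrix (Fin p) (Fin p) ℝ :=
  (cfc Real.sqrt (estA2 K h u T x))⁻¹

/-- The standardized estimator, `F M F'` with `F` and `M` replaced by their estimators. -/
def estB {p : ℕ} (K : ℝ → ℝ) (h u : ℝ) (T : ℕ) (x : ℕ → Fin p → ℝ) :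
    Matrix (Fin p) (Fin p) ℝ :=
  estF K h u T x * estM K h u T x * (estF K h u T x)ᵀ

theorem weightedCov_isHermitian {p : ℕ} (w : ℕ → ℝ) (T : ℕ) (x : ℕ → Fin p → ℝ) :
    (weightedCov w T x).IsHermitian := by
  ext i j
  simp [weightedCov, Matrix.sum_apply, Matrix.vecMulVec_apply, mul_comm]

theorem estB_isHermitian {p : ℕ} (K : ℝ → ℝ) (h u : ℝ) (T : ℕ) (x : ℕ → Fin p → ℝ) :
    (estB K h u T x).IsHermitian := by
  have h1 : (estM K h u T x).IsHermitian :=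
    (weightedCov_isHermitian _ T x).sub (weightedCov_isHermitian _ T x)
  have h2 := Matrix.isHermitian_mul_mul_conjTranspose (estF K h u T x) h1
  rwa [Matrix.conjTranspose_eq_transpose_of_trivial] at h2

/-- The eigenvalues of a symmetric matrix, with multiplicity, in increasing order; the index `k`
runs from `0` to `p - 1`. -/
def ascEigenvalue {p : ℕ} {B : Matrix (Fin p) (Fin p) ℝ} (hB : B.IsHermitian) (k : Fin p) : ℝ :=
  hB.eigenvalues₀ (Fin.cast (Fintype.card_fin p).symm k.rev)

theorem ascEigenvalue_monotone {p : ℕ} {B : Matrix (Fin p) (Fin p) ℝ} (hB : B.IsHermitian) :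
    Monotone (ascEigenvalue hB) := by
  intro k l hkl
  refine hB.eigenvalues₀_antitone ?_
  simpa [Fin.le_def] using Nat.sub_le_sub_left (Nat.succ_le_succ (Fin.le_def.mp hkl)) p

/-- The ordered eigenvalues of the standardized estimator. -/
def gammaHat {p : ℕ} (K : ℝ → ℝ) (h u : ℝ) (T : ℕ) (x : ℕ → Fin p → ℝ) (k : Fin p) : ℝ :=
  ascEigenvalue (estB_isHermitian K h u T x) k

/-- The ordered eigenvalues of the square of the standardized estimator. -/
def gammaHat2 {p : ℕ} (K : ℝ → ℝ) (h u : ℝ) (T : ℕ) (x : ℕ → Fin p → ℝ) (k : Fin p) : ℝ :=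
  ascEigenvalue ((estB_isHermitian K h u T x).pow 2) k

/-- The MINCHI2 statistic `(T h / (‖K‖₂² μ₄)) ∑_{i=1}^r γ̂_{2,i}`; the argument `m4` is the value
of `μ₄`. -/
def minchi2 {p : ℕ} (K : ℝ → ℝ) (h m4 u : ℝ) (T : ℕ) (x : ℕ → Fin p → ℝ) (r : ℕ) : ℝ :=
  (T * h) / ((∫ v, K v ^ 2) * m4) *
    ∑ i ∈ Finset.univ.filter (fun i : Fin p => (i : ℕ) < r), gammaHat2 K h u T x i

/-- The chi-square law with `k` degrees of freedom, the law of the sum of squares of `k`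
independent standard normal variables (the point mass at zero if `k = 0`). -/
def chiSq (k : ℕ) : Measure ℝ :=
  (Measure.pi fun _ : Fin k => gaussianReal 0 1).map fun z => ∑ i, z i ^ 2

/-- The critical value at level `α`: the `(1 - α)`-quantile of the chi-square law. -/
def chiSqCrit (k : ℕ) (α : ℝ) : ℝ :=
  sInf {c : ℝ | 1 - α ≤ (chiSq k).real (Set.Iic c)}

open Classical in
/-- Sequential testing of the hypotheses `d₀ = r` for `r = p, p - 1, …` at level `α`, until one
is not rejected: the largest `r ≤ p` whose statistic does not exceed the `χ²(r(r+1)/2)` critical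
value (the value is `0` if all hypotheses with `r ≥ 1` are rejected). -/
def d0Hat {p : ℕ} (K : ℝ → ℝ) (h m4 α u : ℝ) (T : ℕ) (x : ℕ → Fin p → ℝ) : ℕ :=
  Nat.findGreatest
    (fun r => minchi2 K h m4 u T x r ≤ chiSqCrit (r * (r + 1) / 2) α) p

open Classical in
/-- The number of positive eigenvalues whose square is one of the eigenvalues of the squared matrix
with (one-based) index `d0Hat + 1, …, p`. -/
def dPlusHat {p : ℕ} (K : ℝ → ℝ) (h m4 α u : ℝ) (T : ℕ) (x : ℕ → Fin p → ℝ) : ℕ :=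
  (Finset.univ.filter fun i : Fin p => 0 < gammaHat K h u T x i ∧
    ∃ k : Fin p, d0Hat K h m4 α u T x ≤ (k : ℕ) ∧
      gammaHat K h u T x i ^ 2 = gammaHat2 K h u T x k).card

open Classical in
/-- The same count for the negative eigenvalues. -/
def dMinusHat {p : ℕ} (K : ℝ → ℝ) (h m4 α u : ℝ) (T : ℕ) (x : ℕ → Fin p → ℝ) : ℕ :=
  (Finset.univ.filter fun i : Fin p => gammaHat K h u T x i < 0 ∧
    ∃ k : Fin p, d0Hat K h m4 α u T x ≤ (k : ℕ) ∧
      gammaHat K h u T x i ^ 2 = gammaHat2 K h u T x k).card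

/-- The estimator of the local pseudo nullity. -/
def dHat {p : ℕ} (K : ℝ → ℝ) (h m4 α u : ℝ) (T : ℕ) (x : ℕ → Fin p → ℝ) : ℕ :=
  d0Hat K h m4 α u T x + min (dPlusHat K h m4 α u T x) (dMinusHat K h m4 α u T x)

end VCModel

end

noncomputable section

namespace VCModel

/-! ### Inertia of symmetric forms and the pseudo nullity -/

section

variable {p : ℕ}

/-! If a symmetric `M` has `n₀` zero, `n₊` positive and `n₋` negative eigenvalues, then `d(M) = n₀ +
min(n₊, n₋)` (`pseudoNullity_eq`): a subspace on which the form vanishes is bounded in dimension by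
both `n₀ + n₊` and `n₀ + n₋`, and kernel vectors together with balanced pairs of a positive and a
negative eigenvector attain the bound. It is therefore enough to recover the inertia of `M(u)`.

The matrix `B = F M F'` built from the estimators is congruent to the estimator of `M(u)`. Suppose
that the estimators of `A²(u)` and `M(u)` are entrywise within `δ` of their targets, with `δ` small.
Testing `B` and `B²` on the images, under the estimated root, of the eigenspaces of `M(u)` shows
that `n₀` eigenvalues of `B²` are `O(δ²)`, the others stay above a constant, and the signs of the
large eigenvalues of `B` are those of `M(u)` (`eigenvalue_gap`, `card_signed_eq`). With `δ` of order
`R (Th)^(-1/2)`, the statistic at `r = n₀` is bounded by a constant depending on `R`, while for `r >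
n₀` it is at least a constant times `Th`. The critical values lie in between: they diverge because
`α_T → 0`, and are `o(Th)` because a chi-square tail decays exponentially and `-log α_T = o(Th)`. On
this event the estimate equals the pseudo nullity exactly (`exists_dHat_eq_pseudoNullity`); no limit
law of the statistic is needed.

The event has probability at least `1 - D/R²` for large `T` (`exists_measure_estimation_error_le`).
The bias is `O(h + 1/T + 1/(Th))`, by a Riemann sum estimate for functions of bounded variation, and
is absorbed by `(Th)^(-1/2)` once `Th³ ≤ 1`; the variance is `O(1/(Th))`, by independence over time
and the fourth moment. Finally `R` is arbitrary. -/

theorem exists_orthogonal_diagonalization {B : Matrix (Fin p) (Fin p) ℝ} (hB : B.IsHermitian) :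
    ∃ Q : Matrix (Fin p) (Fin p) ℝ, Qᵀ * Q = 1 ∧ Q * Qᵀ = 1 ∧
      B = Q * diagonal (ascEigenvalue hB) * Qᵀ := by
  -- The reversal makes the decreasing `eigenvalues₀` increasing; the last factor is the equivalence
  -- through which `IsHermitian.eigenvalues` is defined, so that it cancels.
  let e : Fin p ≃ Fin p :=
    (Fin.revPerm.trans (finCongr (Fintype.card_fin p).symm)).trans
      (Fintype.equivOfCardEq (Fintype.card_fin _))
  have he : ascEigenvalue hB = hB.eigenvalues ∘ e := by
    funext k
    simp only [ascEigenvalue, IsHermitian.eigenvalues, e, Function.comp, Equiv.trans_apply,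
      Equiv.symm_apply_apply]
    rfl
  have hU := hB.spectral_theorem
  rw [Unitary.conjStarAlgAut_apply] at hU
  set U : Matrix (Fin p) (Fin p) ℝ := (hB.eigenvectorUnitary : Matrix (Fin p) (Fin p) ℝ)
  have hs : star U = Uᵀ := by
    rw [star_eq_conjTranspose, conjTranspose_eq_transpose_of_trivial]
  have hUU : Uᵀ * U = 1 := by
    rw [← hs]; exact Unitary.coe_star_mul_self _
  have hUU' : U * Uᵀ = 1 := by
    rw [← hs]; exact Unitary.coe_mul_star_self _
  refine ⟨U.submatrix id e, ?_, ?_, ?_⟩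
  · ext i j
    have := congrFun (congrFun hUU (e i)) (e j)
    simpa [Matrix.mul_apply, Matrix.one_apply] using this
  · rw [transpose_submatrix, submatrix_mul_equiv, hUU', submatrix_id_id]
  · rw [he, ← submatrix_diagonal_equiv, submatrix_mul_equiv, transpose_submatrix,
      submatrix_mul_equiv, submatrix_id_id]
    have h2 : (RCLike.ofReal ∘ hB.eigenvalues : Fin p → ℝ) = hB.eigenvalues := by
      funext i; simp
    rw [h2] at hU
    rw [← hs]
    exact hU

theorem exists_mulVec_vanishing {ι : Type*} [Fintype ι] (G : Matrix (Fin p) ι ℝ)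
    (I : Finset (Fin p)) (hI : I.card < Fintype.card ι) :
    ∃ z : ι → ℝ, z ≠ 0 ∧ ∀ i ∈ I, (G *ᵥ z) i = 0 := by
  let f : (ι → ℝ) →ₗ[ℝ] (I → ℝ) := (LinearMap.funLeft ℝ ℝ (Subtype.val : I → Fin p)) ∘ₗ G.mulVecLin
  have hf : LinearMap.ker f ≠ ⊥ := by
    apply LinearMap.ker_ne_bot_of_finrank_lt
    simpa using hI
  obtain ⟨z, hz, hz0⟩ := Submodule.exists_mem_ne_zero_of_ne_bot hf
  refine ⟨z, hz0, fun i hi => ?_⟩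
  exact congrFun (LinearMap.mem_ker.mp hz) ⟨i, hi⟩

theorem dotProduct_transpose_mulVec {ι κ : Type*} [Fintype ι] [Fintype κ] (G : Matrix ι κ ℝ)
    (x : κ → ℝ) (y : ι → ℝ) : (G *ᵥ x) ⬝ᵥ y = x ⬝ᵥ (Gᵀ *ᵥ y) := by
  rw [dotProduct_comm, Matrix.dotProduct_mulVec, ← mulVec_transpose, dotProduct_comm]

theorem dotProduct_diagonalized {ι : Type*} [Fintype ι] [DecidableEq ι] (Q : Matrix (Fin p) ι ℝ)
    (D : ι → ℝ) (x : Fin p → ℝ) :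
    x ⬝ᵥ ((Q * diagonal D * Qᵀ) *ᵥ x) = ∑ i, D i * (Qᵀ *ᵥ x) i ^ 2 := by
  rw [← mulVec_mulVec, ← mulVec_mulVec, dotProduct_comm, dotProduct_transpose_mulVec, dotProduct]
  refine Finset.sum_congr rfl fun i _ => ?_
  rw [mulVec_diagonal]; ring

theorem dotProduct_mulVec_orthogonal {ι κ : Type*} [Fintype ι] [Fintype κ] [DecidableEq κ]
    {Q : Matrix ι κ ℝ} (hQ : Qᵀ * Q = 1) (x : κ → ℝ) :
    (Q *ᵥ x) ⬝ᵥ (Q *ᵥ x) = x ⬝ᵥ x := by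
  rw [dotProduct_transpose_mulVec, mulVec_mulVec, hQ, one_mulVec]

theorem dotProduct_self_eq_sum_sq {ι : Type*} [Fintype ι] (x : ι → ℝ) :
    x ⬝ᵥ x = ∑ i, x i ^ 2 :=
  Finset.sum_congr rfl fun i _ => (sq (x i)).symm

theorem dotProduct_self_nonneg' {ι : Type*} [Fintype ι] (x : ι → ℝ) : 0 ≤ x ⬝ᵥ x := by
  rw [dotProduct_self_eq_sum_sq]; positivity

/-- A form that is at least `c` times the squared norm on a subspace has at least as many
eigenvalues `≥ c` as the dimension of the subspace. -/
theorem card_le_card_eigenvalue_ge {ι : Type*} [Fintype ι] {Q : Matrix (Fin p) (Fin p) ℝ}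
    (hQ : Q * Qᵀ = 1) (D : Fin p → ℝ) (G : Matrix (Fin p) ι ℝ)
    (hG : ∀ z, G *ᵥ z = 0 → z = 0) (c : ℝ)
    (hc : ∀ z, c * ((G *ᵥ z) ⬝ᵥ (G *ᵥ z)) ≤
      (G *ᵥ z) ⬝ᵥ ((Q * diagonal D * Qᵀ) *ᵥ (G *ᵥ z))) :
    Fintype.card ι ≤ (Finset.univ.filter fun i => c ≤ D i).card := by
  by_contra! hlt
  -- Too few eigenvalues `≥ c` leave a nonzero `z` for which `G z` has no component along their
  -- eigenvectors; on the remaining ones the form is strictly below `c` times the squared norm.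
  obtain ⟨z, hz, hzI⟩ := exists_mulVec_vanishing (Qᵀ * G) _ hlt
  apply hz
  apply hG
  have h1 := hc z
  rw [dotProduct_diagonalized] at h1
  have h2 : (G *ᵥ z) ⬝ᵥ (G *ᵥ z) = ∑ i, (Qᵀ *ᵥ (G *ᵥ z)) i ^ 2 := by
    rw [← dotProduct_self_eq_sum_sq]
    exact (dotProduct_mulVec_orthogonal (by rwa [transpose_transpose]) _).symm
  rw [h2, Finset.mul_sum] at h1
  have h0 : ∀ i, (Qᵀ *ᵥ (G *ᵥ z)) i = 0 := by
    intro i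
    by_contra hi
    have hle : ∀ j ∈ Finset.univ,
        D j * (Qᵀ *ᵥ (G *ᵥ z)) j ^ 2 ≤ c * (Qᵀ *ᵥ (G *ᵥ z)) j ^ 2 := by
      intro j _
      by_cases hj : c ≤ D j
      · have := hzI j (by simpa using hj)
        rw [← mulVec_mulVec] at this
        simp [this]
      · exact mul_le_mul_of_nonneg_right (not_le.mp hj).le (sq_nonneg _)
    have hlt : D i * (Qᵀ *ᵥ (G *ᵥ z)) i ^ 2 < c * (Qᵀ *ᵥ (G *ᵥ z)) i ^ 2 := by
      have : ¬ c ≤ D i := by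
        intro hj
        have := hzI i (by simpa using hj)
        rw [← mulVec_mulVec] at this
        exact hi this
      exact mul_lt_mul_of_pos_right (not_le.mp this) (by positivity)
    exact absurd (Finset.sum_lt_sum hle ⟨i, Finset.mem_univ _, hlt⟩) (not_lt.mpr h1)
  have h3 : Qᵀ *ᵥ (G *ᵥ z) = 0 := funext h0
  rw [← one_mulVec (G *ᵥ z), ← hQ, ← mulVec_mulVec, h3, mulVec_zero]

theorem card_le_card_eigenvalue_le {ι : Type*} [Fintype ι] {Q : Matrix (Fin p) (Fin p) ℝ}
    (hQ : Q * Qᵀ = 1) (D : Fin p → ℝ) (G : Matrix (Fin p) ι ℝ)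
    (hG : ∀ z, G *ᵥ z = 0 → z = 0) (c : ℝ)
    (hc : ∀ z, (G *ᵥ z) ⬝ᵥ ((Q * diagonal D * Qᵀ) *ᵥ (G *ᵥ z)) ≤
      c * ((G *ᵥ z) ⬝ᵥ (G *ᵥ z))) :
    Fintype.card ι ≤ (Finset.univ.filter fun i => D i ≤ c).card := by
  have := card_le_card_eigenvalue_ge hQ (fun i => - D i) G hG (-c) (by
    intro z
    have := hc z
    rw [dotProduct_diagonalized] at this ⊢
    simp only [neg_mul, Finset.sum_neg_distrib]
    linarith)
  simpa using this

/-- On the range of `C` the form is zero, hence both `≥ 0` and `≤ 0`, and the two counting lemmas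
apply with constant `0`. -/
theorem pseudoNullity_le {R M : Matrix (Fin p) (Fin p) ℝ} {μ : Fin p → ℝ} (hR : R * Rᵀ = 1)
    (hM : M = R * diagonal μ * Rᵀ) {d : ℕ} {C : Matrix (Fin p) (Fin d) ℝ}
    (hC : Cᵀ * C = 1) (hCM : Cᵀ * M * C = 0) :
    d ≤ (Finset.univ.filter fun i => μ i ≤ 0).card ∧
      d ≤ (Finset.univ.filter fun i => 0 ≤ μ i).card := by
  have hinj : ∀ z, C *ᵥ z = 0 → z = 0 := by
    intro z hz
    rw [← one_mulVec z, ← hC, ← mulVec_mulVec, hz, mulVec_zero]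
  have hform : ∀ z, (C *ᵥ z) ⬝ᵥ ((R * diagonal μ * Rᵀ) *ᵥ (C *ᵥ z)) = 0 := by
    intro z
    rw [← hM, dotProduct_transpose_mulVec, mulVec_mulVec, mulVec_mulVec, hCM,
      zero_mulVec, dotProduct_zero]
  constructor
  · simpa using card_le_card_eigenvalue_le hR μ C hinj 0 (fun z => by rw [hform]; simp)
  · simpa using card_le_card_eigenvalue_ge hR μ C hinj 0 (fun z => by rw [hform]; simp)

theorem card_neg_add_card_zero_add_card_pos (μ : Fin p → ℝ) :
    (Finset.univ.filter fun i => μ i < 0).card + (Finset.univ.filter fun i => μ i = 0).card +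
      (Finset.univ.filter fun i => 0 < μ i).card = p := by
  have h1 : (Finset.univ.filter fun i => μ i < 0).card +
      (Finset.univ.filter fun i => ¬ μ i < 0).card = p := by
    simpa using Finset.card_filter_add_card_filter_not (s := (Finset.univ : Finset (Fin p)))
      (fun i => μ i < 0)
  have h2 : (Finset.univ.filter fun i => ¬ μ i < 0).card =
      (Finset.univ.filter fun i => μ i = 0).card + (Finset.univ.filter fun i => 0 < μ i).card := by
    rw [← Finset.card_union_of_disjoint]
    · congr 1; ext i; simp [le_iff_lt_or_eq, or_comm, eq_comm]
    · rw [Finset.disjoint_filter]; intro i _ h; simp [h]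
  omega

/-- Kernel vectors are isotropic already. Each of `m` positive eigenvectors is combined with its own
negative one so that the two contributions to the form cancel. -/
theorem exists_isotropic_frame (μ : Fin p → ℝ) (m : ℕ)
    (hpos : m ≤ (Finset.univ.filter fun i => 0 < μ i).card)
    (hneg : m ≤ (Finset.univ.filter fun i => μ i < 0).card) :
    ∃ E : Matrix (Fin p) ({i : Fin p // μ i = 0} ⊕ Fin m) ℝ,
      Eᵀ * E = 1 ∧ Eᵀ * diagonal μ * E = 0 := by
  obtain ⟨f⟩ : Nonempty (Fin m ↪ {i : Fin p // 0 < μ i}) := by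
    apply Function.Embedding.nonempty_of_card_le
    rwa [Fintype.card_fin, Fintype.card_subtype]
  obtain ⟨g⟩ : Nonempty (Fin m ↪ {i : Fin p // μ i < 0}) := by
    apply Function.Embedding.nonempty_of_card_le
    rwa [Fintype.card_fin, Fintype.card_subtype]
  -- The weights solve `a² + b² = 1` and `a² μ(f k) + b² μ(g k) = 0`.
  let a : Fin m → ℝ := fun k => √(-μ (g k) / (μ (f k) - μ (g k)))
  let b : Fin m → ℝ := fun k => √(μ (f k) / (μ (f k) - μ (g k)))
  have hd : ∀ k, 0 < μ (f k) - μ (g k) := fun k => by have := (f k).2; have := (g k).2; linarith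
  have ha : ∀ k, a k * a k = -μ (g k) / (μ (f k) - μ (g k)) := fun k =>
    Real.mul_self_sqrt (div_nonneg (by have := (g k).2; linarith) (hd k).le)
  have hb : ∀ k, b k * b k = μ (f k) / (μ (f k) - μ (g k)) := fun k =>
    Real.mul_self_sqrt (div_nonneg (f k).2.le (hd k).le)
  let c : {i : Fin p // μ i = 0} ⊕ Fin m → Fin p → ℝ := Sum.elim (fun j => Pi.single j.1 1)
    (fun k => a k • Pi.single (f k).1 1 + b k • Pi.single (g k).1 1)
  have hfg : ∀ k l, (f k).1 ≠ (g l).1 := fun k l h => by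
    have h1 := (f k).2; have h2 := (g l).2; rw [h] at h1; linarith
  have hf0 : ∀ k (j : {i : Fin p // μ i = 0}), (f k).1 ≠ j.1 := fun k j h => by
    have h1 := (f k).2; have h2 := j.2; rw [h] at h1; linarith
  have hg0 : ∀ k (j : {i : Fin p // μ i = 0}), (g k).1 ≠ j.1 := fun k j h => by
    have h1 := (g k).2; have h2 := j.2; rw [h] at h1; linarith
  have hff : ∀ k l, k ≠ l → (f k).1 ≠ (f l).1 := fun k l hkl h =>
    hkl (f.injective (Subtype.ext h))
  have hgg : ∀ k l, k ≠ l → (g k).1 ≠ (g l).1 := fun k l hkl h =>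
    hkl (g.injective (Subtype.ext h))
  have hentry : ∀ (ρ : Fin p → ℝ) s t, ((Matrix.of c) * diagonal ρ * (Matrix.of c)ᵀ) s t =
      ∑ i, ρ i * c s i * c t i := by
    intro ρ s t
    rw [Matrix.mul_apply]
    refine Finset.sum_congr rfl fun i _ => ?_
    rw [mul_diagonal, of_apply, transpose_apply, of_apply]; ring
  -- A general weight `ρ` covers both claims: `ρ = 1` gives orthonormality and `ρ = μ` gives
  -- isotropy.
  have key : ∀ (ρ : Fin p → ℝ) s t, ∑ i, ρ i * c s i * c t i =
      if s = t then Sum.elim (fun j => ρ j.1)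
        (fun k => ρ (f k) * (a k * a k) + ρ (g k) * (b k * b k)) s else 0 := by
    intro ρ s t
    rcases s with j | k <;> rcases t with j' | k'
    · by_cases h : j = j'
      · subst h; simp [c, Pi.single_apply]
      · have : j.1 ≠ j'.1 := fun h' => h (Subtype.ext h')
        simp [c, Pi.single_apply, h, this.symm]
    · simp [c, Pi.single_apply, (hf0 k' j).symm, (hg0 k' j).symm]
    · simp [c, Pi.single_apply, (hf0 k j').symm, (hg0 k j').symm]
    · by_cases h : k = k'
      · subst h
        simp [c, Pi.single_apply, mul_add, add_mul, Finset.sum_add_distrib, hfg k k,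
          (hfg k k).symm]
        ring
      · simp [c, Pi.single_apply, mul_add, add_mul, Finset.sum_add_distrib,
          (hfg k k').symm, hfg k' k, h, (hff k k' h).symm, (hgg k k' h).symm]
  refine ⟨(Matrix.of c)ᵀ, ?_, ?_⟩
  · rw [transpose_transpose]
    ext s t
    have := hentry (fun _ => 1) s t
    rw [diagonal_one, Matrix.mul_one, key] at this
    rw [this, Matrix.one_apply]
    split_ifs with hst
    · rcases s with j | k
      · simp
      · have := hd k
        simp only [Sum.elim_inr, ha, hb]
        field_simp
        ring
    · rfl
  · rw [transpose_transpose]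
    ext s t
    rw [hentry, key]
    split_ifs with hst
    · rcases s with j | k
      · simpa using j.2
      · have := hd k
        rw [Matrix.zero_apply]
        simp only [Sum.elim_inr, ha, hb]
        field_simp
        ring
    · rfl

/-- The pseudo nullity in terms of the inertia. -/
theorem pseudoNullity_eq {R M : Matrix (Fin p) (Fin p) ℝ} {μ : Fin p → ℝ} (hR : R * Rᵀ = 1)
    (hR' : Rᵀ * R = 1) (hM : M = R * diagonal μ * Rᵀ) :
    pseudoNullity M = (Finset.univ.filter fun i => μ i = 0).card +
      min (Finset.univ.filter fun i => 0 < μ i).card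
        (Finset.univ.filter fun i => μ i < 0).card := by
  apply le_antisymm
  · obtain ⟨C, hC, hCM⟩ := (pseudoNullity_isGreatest M).1
    obtain ⟨h1, h2⟩ := pseudoNullity_le hR hM hC hCM
    have h3 := card_neg_add_card_zero_add_card_pos μ
    have h4 : (Finset.univ.filter fun i => μ i ≤ 0).card +
        (Finset.univ.filter fun i => ¬ μ i ≤ 0).card = p := by
      simpa using Finset.card_filter_add_card_filter_not (s := (Finset.univ : Finset (Fin p)))
        (fun i => μ i ≤ 0)
    have h5 : (Finset.univ.filter fun i => 0 ≤ μ i).card +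
        (Finset.univ.filter fun i => ¬ 0 ≤ μ i).card = p := by
      simpa using Finset.card_filter_add_card_filter_not (s := (Finset.univ : Finset (Fin p)))
        (fun i => 0 ≤ μ i)
    simp only [not_le] at h4 h5
    omega
  · apply (pseudoNullity_isGreatest M).2
    set m := min (Finset.univ.filter fun i => 0 < μ i).card
        (Finset.univ.filter fun i => μ i < 0).card
    obtain ⟨E, hE, hE0⟩ := exists_isotropic_frame μ m (min_le_left _ _) (min_le_right _ _)
    have hcard : Fintype.card ({i : Fin p // μ i = 0} ⊕ Fin m) =
        (Finset.univ.filter fun i => μ i = 0).card + m := by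
      rw [Fintype.card_sum, Fintype.card_fin, Fintype.card_subtype]
    let e := (Fintype.equivFinOfCardEq hcard).symm
    have h1 : (R * E)ᵀ * (R * E) = 1 := by
      rw [transpose_mul, Matrix.mul_assoc, ← Matrix.mul_assoc Rᵀ, hR', Matrix.one_mul, hE]
    have h2 : (R * E)ᵀ * M * (R * E) = 0 := by
      have : (R * E)ᵀ * M * (R * E) = Eᵀ * (Rᵀ * R) * diagonal μ * (Rᵀ * R) * E := by
        rw [transpose_mul, hM]; simp only [Matrix.mul_assoc]
      rw [this, hR', Matrix.mul_one, Matrix.mul_one, hE0]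
    refine ⟨(R * E).submatrix id e, ?_, ?_⟩
    · ext i j
      have := congrFun (congrFun h1 (e i)) (e j)
      simpa [Matrix.mul_apply, Matrix.one_apply] using this
    · ext i j
      have := congrFun (congrFun h2 (e i)) (e j)
      simpa [Matrix.mul_apply] using this

end

/-! ### Eigenvalues of the standardized matrix under perturbation -/

section

variable {p : ℕ}

theorem le_of_le_card_filter_le {f : Fin p → ℝ} (hf : Monotone f) {d : ℕ} {s : ℝ}
    (h : d ≤ (Finset.univ.filter fun i => f i ≤ s).card) {k : Fin p} (hk : (k : ℕ) < d) :
    f k ≤ s := by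
  by_contra! hlt
  have hsub : (Finset.univ.filter fun i => f i ≤ s) ⊆ Finset.Iio k := by
    intro i hi
    rw [Finset.mem_Iio]
    by_contra! hki
    have := hf hki
    simp at hi
    linarith
  have := Finset.card_le_card hsub
  rw [Fin.card_Iio] at this
  omega

theorem le_of_le_card_filter_ge {f : Fin p → ℝ} (hf : Monotone f) {d : ℕ} {s : ℝ}
    (h : p ≤ (Finset.univ.filter fun i => s ≤ f i).card + d) {k : Fin p} (hk : d ≤ (k : ℕ)) :
    s ≤ f k := by
  by_contra! hlt
  have hsub : (Finset.univ.filter fun i => s ≤ f i) ⊆ Finset.Ioi k := by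
    intro i hi
    rw [Finset.mem_Ioi]
    by_contra! hki
    have := hf hki
    simp at hi
    linarith
  have := Finset.card_le_card hsub
  rw [Fin.card_Ioi] at this
  have := k.2
  omega

theorem sq_diagonalized {Q : Matrix (Fin p) (Fin p) ℝ} (hQ : Qᵀ * Q = 1) (D : Fin p → ℝ) :
    (Q * diagonal D * Qᵀ) ^ 2 = Q * diagonal (fun j => D j ^ 2) * Qᵀ := by
  calc (Q * diagonal D * Qᵀ) ^ 2
      = Q * diagonal D * (Qᵀ * Q) * diagonal D * Qᵀ := by simp only [sq, Matrix.mul_assoc]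
    _ = _ := by
      rw [hQ, Matrix.mul_one, Matrix.mul_assoc Q, diagonal_mul_diagonal]
      simp only [sq]

/-- Squaring does not preserve the order, so indices cannot be matched directly. The orthogonal
matrix `Wᵀ Q` intertwines two diagonalizations of `B²`; its `i`-th column has a nonzero entry `k`,
and there the two eigenvalues must agree. -/
theorem sq_ascEigenvalue_mem_range {B : Matrix (Fin p) (Fin p) ℝ} (hB : B.IsHermitian)
    (i : Fin p) : ∃ k, ascEigenvalue hB i ^ 2 = ascEigenvalue (hB.pow 2) k := by
  obtain ⟨Q, hQ1, hQ2, hQ⟩ := exists_orthogonal_diagonalization hB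
  obtain ⟨W, hW1, hW2, hW⟩ := exists_orthogonal_diagonalization (hB.pow 2)
  set D := ascEigenvalue hB
  set E := ascEigenvalue (hB.pow 2)
  have h1 : B ^ 2 = Q * diagonal (fun j => D j ^ 2) * Qᵀ := by
    rw [← sq_diagonalized hQ1, ← hQ]
  have h2 : diagonal E * (Wᵀ * Q) = (Wᵀ * Q) * diagonal (fun j => D j ^ 2) := by
    calc diagonal E * (Wᵀ * Q) = (Wᵀ * W) * diagonal E * (Wᵀ * Q) := by rw [hW1, Matrix.one_mul]
      _ = Wᵀ * (W * diagonal E * Wᵀ) * Q := by simp only [Matrix.mul_assoc]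
      _ = Wᵀ * (Q * diagonal (fun j => D j ^ 2) * Qᵀ) * Q := by rw [← hW, h1]
      _ = Wᵀ * Q * diagonal (fun j => D j ^ 2) * (Qᵀ * Q) := by simp only [Matrix.mul_assoc]
      _ = _ := by rw [hQ1, Matrix.mul_one]
  have hex : ∃ k, (Wᵀ * Q) k i ≠ 0 := by
    by_contra! h0
    have h3 : (Wᵀ * Q)ᵀ * (Wᵀ * Q) = 1 := by
      rw [transpose_mul, transpose_transpose, Matrix.mul_assoc, ← Matrix.mul_assoc W, hW2,
        Matrix.one_mul, hQ1]
    have h4 := congrFun (congrFun h3 i) i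
    rw [Matrix.mul_apply] at h4
    simp [h0] at h4
  obtain ⟨k, hk⟩ := hex
  refine ⟨k, ?_⟩
  have h5 := congrFun (congrFun h2 k) i
  rw [diagonal_mul, mul_diagonal] at h5
  exact mul_left_cancel₀ hk (by rw [← h5]; ring)

theorem abs_dotProduct_le {ι : Type*} [Fintype ι] {x y : ι → ℝ} {δ : ℝ} (hδ : 0 ≤ δ)
    (h : y ⬝ᵥ y ≤ δ ^ 2 * (x ⬝ᵥ x)) : |x ⬝ᵥ y| ≤ δ * (x ⬝ᵥ x) := by
  apply abs_le_of_sq_le_sq _ (mul_nonneg hδ (dotProduct_self_nonneg' x))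
  have h1 : (x ⬝ᵥ y) ^ 2 ≤ (x ⬝ᵥ x) * (y ⬝ᵥ y) := by
    rw [dotProduct_self_eq_sum_sq, dotProduct_self_eq_sum_sq]
    exact Finset.sum_mul_sq_le_sq_mul_sq _ _ _
  nlinarith [dotProduct_self_nonneg' x]

theorem dotProduct_self_le_two_mul_add {ι : Type*} [Fintype ι] (x y : ι → ℝ) :
    x ⬝ᵥ x ≤ 2 * (y ⬝ᵥ y) + 2 * ((y - x) ⬝ᵥ (y - x)) := by
  simp only [dotProduct_self_eq_sum_sq, Finset.mul_sum, ← Finset.sum_add_distrib]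
  refine Finset.sum_le_sum fun i _ => ?_
  simp only [Pi.sub_apply]
  nlinarith [sq_nonneg (2 * y i - x i)]

/-- Eigenvalues of `F Mh F'`, where `F` is a symmetric inverse root, when `Mh` is close to a matrix
`M` with eigenvalues `μ`. -/
theorem eigenvalue_gap {N F Mh M R : Matrix (Fin p) (Fin p) ℝ} {μ : Fin p → ℝ} {a b δ m : ℝ}
    (hN : Nᵀ = N) (hNF : N * F = 1) (ha : 0 < a) (hb : 0 < b)
    (hlow : ∀ w, a * (w ⬝ᵥ w) ≤ (N *ᵥ w) ⬝ᵥ (N *ᵥ w))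
    (hup : ∀ w, (N *ᵥ w) ⬝ᵥ (N *ᵥ w) ≤ b * (w ⬝ᵥ w))
    (hδ : ∀ w, ((Mh - M) *ᵥ w) ⬝ᵥ ((Mh - M) *ᵥ w) ≤ δ ^ 2 * (w ⬝ᵥ w)) (hδ0 : 0 ≤ δ)
    (hδm : δ ≤ m / 2) (hm : 0 < m) (hR' : Rᵀ * R = 1)
    (hM : M = R * diagonal μ * Rᵀ) (hμ : ∀ i, μ i ≠ 0 → m ≤ |μ i|)
    (hB : (F * Mh * Fᵀ).IsHermitian) :
    (∀ k : Fin p, (k : ℕ) < (Finset.univ.filter fun i => μ i = 0).card →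
      ascEigenvalue (hB.pow 2) k ≤ δ ^ 2 / a ^ 2) ∧
    (∀ k : Fin p, (Finset.univ.filter fun i => μ i = 0).card ≤ (k : ℕ) →
      (m / (2 * b)) ^ 2 ≤ ascEigenvalue (hB.pow 2) k) ∧
    (Finset.univ.filter fun i => 0 < μ i).card ≤
      (Finset.univ.filter fun i => m / (2 * b) ≤ ascEigenvalue hB i).card ∧
    (Finset.univ.filter fun i => μ i < 0).card ≤
      (Finset.univ.filter fun i => ascEigenvalue hB i ≤ -(m / (2 * b))).card ∧
    (Finset.univ.filter fun i => μ i = 0).card ≤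
      (Finset.univ.filter fun i => ascEigenvalue hB i ^ 2 ≤ δ ^ 2 / a ^ 2).card := by
  have hFN : F * N = 1 := mul_eq_one_comm.mp hNF
  have hFtN : Fᵀ * N = 1 := by rw [← hN, ← transpose_mul, hNF, transpose_one]
  set B := F * Mh * Fᵀ with hBdef
  obtain ⟨Q, hQ1, hQ2, hQ⟩ := exists_orthogonal_diagonalization hB
  obtain ⟨W, hW1, hW2, hW⟩ := exists_orthogonal_diagonalization (hB.pow 2)
  have hBsq : B ^ 2 = Q * diagonal (fun j => ascEigenvalue hB j ^ 2) * Qᵀ := by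
    rw [← sq_diagonalized hQ1, ← hQ]
  have hBt : Bᵀ = B := by
    rw [← conjTranspose_eq_transpose_of_trivial]; exact hB
  -- the subspaces spanned by eigenvectors of `M`
  let G : (J : Fin p → Prop) → Matrix (Fin p) {i // J i} ℝ := fun J => R.submatrix id Subtype.val
  have hGG : ∀ (J : Fin p → Prop) [DecidablePred J], (G J)ᵀ * G J = 1 := by
    intro J _
    ext i j
    have := congrFun (congrFun hR' i.1) j.1
    rw [Matrix.mul_apply] at this ⊢
    simpa [G, Matrix.one_apply, Subtype.ext_iff] using this
  have hMR : M * R = R * diagonal μ := by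
    rw [hM, Matrix.mul_assoc, hR', Matrix.mul_one]
  have hMG : ∀ (J : Fin p → Prop) [DecidablePred J], M * G J = G J * diagonal (fun i : {i // J i} => μ i.1) := by
    intro J _
    ext i j
    have := congrFun (congrFun hMR i) j.1
    rw [mul_diagonal, Matrix.mul_apply] at this
    rw [mul_diagonal, Matrix.mul_apply]
    simpa [G] using this
  have hinj : ∀ (J : Fin p → Prop) [DecidablePred J], ∀ z, (N * G J) *ᵥ z = 0 → z = 0 := by
    intro J _ z hz
    have h1 : (G J)ᵀ * (F * (N * G J)) = 1 := by
      rw [← Matrix.mul_assoc F, hFN, Matrix.one_mul, hGG]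
    rw [← one_mulVec z, ← h1, ← mulVec_mulVec, ← mulVec_mulVec, hz, mulVec_zero, mulVec_zero]
  -- Vectors `N w` are the trial vectors: `N` cancels a factor `F`, so the forms of `B` and `B²` at
  -- `N w` become expressions in `Mh w`.
  have hBN : ∀ w, B *ᵥ (N *ᵥ w) = F *ᵥ (Mh *ᵥ w) := by
    intro w
    rw [mulVec_mulVec, hBdef, Matrix.mul_assoc, hFtN, Matrix.mul_one, mulVec_mulVec]
  have hNFx : ∀ x, N *ᵥ (F *ᵥ x) = x := fun x => by rw [mulVec_mulVec, hNF, one_mulVec]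
  have hFup : ∀ x, a * ((F *ᵥ x) ⬝ᵥ (F *ᵥ x)) ≤ x ⬝ᵥ x := fun x => by
    have := hlow (F *ᵥ x); rwa [hNFx] at this
  have hFlow : ∀ x, x ⬝ᵥ x ≤ b * ((F *ᵥ x) ⬝ᵥ (F *ᵥ x)) := fun x => by
    have := hup (F *ᵥ x); rwa [hNFx] at this
  have hsqform : ∀ w, (N *ᵥ w) ⬝ᵥ ((B ^ 2) *ᵥ (N *ᵥ w)) =
      (F *ᵥ (Mh *ᵥ w)) ⬝ᵥ (F *ᵥ (Mh *ᵥ w)) := by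
    intro w
    rw [← hBN, dotProduct_transpose_mulVec B, hBt, sq, ← mulVec_mulVec]
  have hform : ∀ w, (N *ᵥ w) ⬝ᵥ (B *ᵥ (N *ᵥ w)) = w ⬝ᵥ (M *ᵥ w) + w ⬝ᵥ ((Mh - M) *ᵥ w) := by
    intro w
    rw [hBN, dotProduct_transpose_mulVec, hN, hNFx, ← dotProduct_add, sub_mulVec]
    congr 1
    abel
  have hGz : ∀ (J : Fin p → Prop) [DecidablePred J] z, (G J *ᵥ z) ⬝ᵥ (G J *ᵥ z) = z ⬝ᵥ z := by
    intro J _ z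
    exact dotProduct_mulVec_orthogonal (hGG J) z
  have hMz : ∀ (J : Fin p → Prop) [DecidablePred J] z, M *ᵥ (G J *ᵥ z) = G J *ᵥ (fun i => μ i.1 * z i) := by
    intro J _ z
    rw [mulVec_mulVec, hMG, ← mulVec_mulVec]
    congr 1
    funext i
    rw [mulVec_diagonal]
  have hMquad : ∀ (J : Fin p → Prop) [DecidablePred J] z, (G J *ᵥ z) ⬝ᵥ (M *ᵥ (G J *ᵥ z)) = ∑ i, μ i.1 * z i ^ 2 := by
    intro J _ z
    rw [hMz, dotProduct_transpose_mulVec, mulVec_mulVec, hGG, one_mulVec]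
    exact Finset.sum_congr rfl fun i _ => by ring
  have hcard : ∀ (J : Fin p → Prop) [DecidablePred J], Fintype.card {i // J i} =
      (Finset.univ.filter J).card := fun J _ => Fintype.card_subtype J
  -- small eigenvalues
  have hsmall : ∀ z, ((N * G (fun i => μ i = 0)) *ᵥ z) ⬝ᵥ
      ((B ^ 2) *ᵥ ((N * G (fun i => μ i = 0)) *ᵥ z)) ≤
      δ ^ 2 / a ^ 2 * (((N * G (fun i => μ i = 0)) *ᵥ z) ⬝ᵥ
        ((N * G (fun i => μ i = 0)) *ᵥ z)) := by
    intro z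
    rw [← mulVec_mulVec, hsqform]
    set w := G (fun i => μ i = 0) *ᵥ z
    -- On the kernel of `M` only the error of size `δ` acts. The bound `a` enters twice, in `|F x|²
    -- ≤ |x|²/a` and `|w|² ≤ |N w|²/a`.
    have h1 : Mh *ᵥ w = (Mh - M) *ᵥ w := by
      rw [sub_mulVec, hMz]
      have : (fun i : {i // μ i = 0} => μ i.1 * z i) = 0 := by
        funext i; simp [i.2]
      rw [this, mulVec_zero, sub_zero]
    have h2 := hFup (Mh *ᵥ w)
    have h3 := hδ w
    have h4 := hlow w
    rw [h1] at h2 ⊢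
    rw [div_mul_eq_mul_div, le_div_iff₀ (by positivity)]
    have h5 : δ ^ 2 * (a * (w ⬝ᵥ w)) ≤ δ ^ 2 * ((N *ᵥ w) ⬝ᵥ (N *ᵥ w)) := by gcongr
    nlinarith
  -- large eigenvalues
  have hlarge : ∀ z, (m / (2 * b)) ^ 2 * (((N * G (fun i => μ i ≠ 0)) *ᵥ z) ⬝ᵥ
        ((N * G (fun i => μ i ≠ 0)) *ᵥ z)) ≤ ((N * G (fun i => μ i ≠ 0)) *ᵥ z) ⬝ᵥ
      ((B ^ 2) *ᵥ ((N * G (fun i => μ i ≠ 0)) *ᵥ z)) := by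
    intro z
    rw [← mulVec_mulVec, hsqform]
    set w := G (fun i => μ i ≠ 0) *ᵥ z with hw
    have h1 : m ^ 2 * (w ⬝ᵥ w) ≤ (M *ᵥ w) ⬝ᵥ (M *ᵥ w) := by
      rw [hMz, hGz, hGz, dotProduct_self_eq_sum_sq, dotProduct_self_eq_sum_sq, Finset.mul_sum]
      refine Finset.sum_le_sum fun i _ => ?_
      rw [mul_pow]
      have : m ^ 2 ≤ μ i.1 ^ 2 := by
        rw [← sq_abs (μ i.1)]
        exact pow_le_pow_left₀ hm.le (hμ _ i.2) 2
      gcongr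
    -- From `m²|w|² ≤ 2|Mh w|² + 2δ²|w|²` and `δ ≤ m/2` there remains `|Mh w|² ≥ (m²/4)|w|²`.
    have h2 := dotProduct_self_le_two_mul_add (M *ᵥ w) (Mh *ᵥ w)
    rw [← sub_mulVec] at h2
    have h3 := hδ w
    have h4 := hup w
    have h5 := hFlow (Mh *ᵥ w)
    have h6 : δ ^ 2 ≤ m ^ 2 / 4 := by nlinarith
    have h7 : δ ^ 2 * (w ⬝ᵥ w) ≤ m ^ 2 / 4 * (w ⬝ᵥ w) :=
      mul_le_mul_of_nonneg_right h6 (dotProduct_self_nonneg' w)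
    have h8 : m ^ 2 / 4 * (w ⬝ᵥ w) ≤ b * ((F *ᵥ (Mh *ᵥ w)) ⬝ᵥ (F *ᵥ (Mh *ᵥ w))) := by linarith
    have h9 : m ^ 2 / 4 * ((N *ᵥ w) ⬝ᵥ (N *ᵥ w)) ≤ m ^ 2 / 4 * (b * (w ⬝ᵥ w)) := by gcongr
    have h10 := mul_le_mul_of_nonneg_left h8 hb.le
    have e : (m / (2 * b)) ^ 2 = (m ^ 2 / 4) / b ^ 2 := by field_simp; norm_num
    rw [e, div_mul_eq_mul_div, div_le_iff₀ (by positivity)]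
    linarith
  -- The error costs at most half of the spectral gap `m`; passing from `w` to `N w` then divides by
  -- `b`.
  have herr : ∀ w, |w ⬝ᵥ ((Mh - M) *ᵥ w)| ≤ m / 2 * (w ⬝ᵥ w) := fun w =>
    (abs_dotProduct_le hδ0 (hδ w)).trans
      (mul_le_mul_of_nonneg_right hδm (dotProduct_self_nonneg' w))
  have hscale : ∀ w, m / (2 * b) * ((N *ᵥ w) ⬝ᵥ (N *ᵥ w)) ≤ m / 2 * (w ⬝ᵥ w) := by
    intro w
    have h9 : m / 2 * ((N *ᵥ w) ⬝ᵥ (N *ᵥ w)) ≤ m / 2 * (b * (w ⬝ᵥ w)) := by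
      have := hup w; gcongr
    have e : m / (2 * b) = m / 2 / b := by field_simp
    rw [e, div_mul_eq_mul_div, div_le_iff₀ hb]
    linarith
  have hposform : ∀ z, m / (2 * b) * (((N * G (fun i => 0 < μ i)) *ᵥ z) ⬝ᵥ
        ((N * G (fun i => 0 < μ i)) *ᵥ z)) ≤ ((N * G (fun i => 0 < μ i)) *ᵥ z) ⬝ᵥ
      (B *ᵥ ((N * G (fun i => 0 < μ i)) *ᵥ z)) := by
    intro z
    rw [← mulVec_mulVec, hform]
    set w := G (fun i => 0 < μ i) *ᵥ z with hw
    have h1 : m * (w ⬝ᵥ w) ≤ w ⬝ᵥ (M *ᵥ w) := by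
      rw [hMquad, hGz, dotProduct_self_eq_sum_sq, Finset.mul_sum]
      refine Finset.sum_le_sum fun i _ => ?_
      have := hμ i.1 i.2.ne'
      rw [abs_of_pos i.2] at this
      gcongr
    have h2 := (abs_le.mp (herr w)).1
    have h3 := hscale w
    linarith
  have hnegform : ∀ z, ((N * G (fun i => μ i < 0)) *ᵥ z) ⬝ᵥ
      (B *ᵥ ((N * G (fun i => μ i < 0)) *ᵥ z)) ≤ -(m / (2 * b)) *
        (((N * G (fun i => μ i < 0)) *ᵥ z) ⬝ᵥ ((N * G (fun i => μ i < 0)) *ᵥ z)) := by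
    intro z
    rw [← mulVec_mulVec, hform]
    set w := G (fun i => μ i < 0) *ᵥ z with hw
    have h1 : w ⬝ᵥ (M *ᵥ w) ≤ -m * (w ⬝ᵥ w) := by
      rw [hMquad, hGz, dotProduct_self_eq_sum_sq, Finset.mul_sum]
      refine Finset.sum_le_sum fun i _ => ?_
      have := hμ i.1 i.2.ne
      rw [abs_of_neg i.2] at this
      have : μ i.1 ≤ -m := by linarith
      gcongr
    have h2 := (abs_le.mp (herr w)).2
    have h3 := hscale w
    linarith
  refine ⟨?_, ?_, ?_, ?_, ?_⟩
  · intro k hk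
    refine le_of_le_card_filter_le (ascEigenvalue_monotone _) ?_ hk
    rw [← hcard]
    refine card_le_card_eigenvalue_le hW2 _ _ (hinj _) _ ?_
    rw [← hW]; exact hsmall
  · intro k hk
    refine le_of_le_card_filter_ge (ascEigenvalue_monotone _) ?_ hk
    have h1 := card_le_card_eigenvalue_ge hW2 (ascEigenvalue (hB.pow 2)) _ (hinj _) _
      (by rw [← hW]; exact hlarge)
    rw [hcard] at h1
    have h3 : (Finset.univ.filter fun i => μ i = 0).card +
        (Finset.univ.filter fun i => μ i ≠ 0).card = p := by
      simpa using Finset.card_filter_add_card_filter_not (s := (Finset.univ : Finset (Fin p)))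
        (fun i => μ i = 0)
    omega
  · rw [← hcard]
    refine card_le_card_eigenvalue_ge hQ2 _ _ (hinj _) _ ?_
    rw [← hQ]; exact hposform
  · rw [← hcard]
    refine card_le_card_eigenvalue_le hQ2 _ _ (hinj _) _ ?_
    rw [← hQ]; exact hnegform
  -- The bound for `B²` is read in the eigenbasis `Q` of `B`, so it counts squares of the
  -- eigenvalues of `B` itself.
  · rw [← hcard]
    refine card_le_card_eigenvalue_le hQ2 _ _ (hinj _) _ ?_
    rw [← hBsq]; exact hsmall

open Classical in
/-- Counting signed eigenvalues `γ` above a spectral gap of the squared eigenvalues `γ2`. -/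
theorem card_signed_eq {γ γ2 : Fin p → ℝ} (hmem : ∀ i, ∃ k, γ i ^ 2 = γ2 k)
    {s c : ℝ} (hc : 0 < c) (hsc : s < c ^ 2) {d₀ dp dm : ℕ} (hp : dm + d₀ + dp = p)
    (h1 : ∀ k : Fin p, (k : ℕ) < d₀ → γ2 k ≤ s)
    (h2 : ∀ k : Fin p, d₀ ≤ (k : ℕ) → c ^ 2 ≤ γ2 k)
    (h3 : dp ≤ (Finset.univ.filter fun i => c ≤ γ i).card)
    (h4 : dm ≤ (Finset.univ.filter fun i => γ i ≤ -c).card)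
    (h5 : d₀ ≤ (Finset.univ.filter fun i => γ i ^ 2 ≤ s).card) :
    (Finset.univ.filter fun i : Fin p => 0 < γ i ∧
      ∃ k : Fin p, d₀ ≤ (k : ℕ) ∧ γ i ^ 2 = γ2 k).card = dp ∧
    (Finset.univ.filter fun i : Fin p => γ i < 0 ∧
      ∃ k : Fin p, d₀ ≤ (k : ℕ) ∧ γ i ^ 2 = γ2 k).card = dm := by
  have hbig : ∀ i, c ^ 2 ≤ γ i ^ 2 → ∃ k : Fin p, d₀ ≤ (k : ℕ) ∧ γ i ^ 2 = γ2 k := by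
    intro i hi
    obtain ⟨k, hk⟩ := hmem i
    refine ⟨k, ?_, hk⟩
    by_contra! hlt
    have := h1 k hlt
    linarith
  set X := Finset.univ.filter fun i : Fin p => 0 < γ i ∧
      ∃ k : Fin p, d₀ ≤ (k : ℕ) ∧ γ i ^ 2 = γ2 k with hX
  set X' := Finset.univ.filter fun i : Fin p => γ i < 0 ∧
      ∃ k : Fin p, d₀ ≤ (k : ℕ) ∧ γ i ^ 2 = γ2 k with hX'
  set Z := Finset.univ.filter fun i : Fin p => γ i ^ 2 ≤ s with hZ
  have hX1 : dp ≤ X.card := h3.trans (Finset.card_le_card fun i hi => by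
    have hi' : c ≤ γ i := by simpa using hi
    simp only [hX, Finset.mem_filter, Finset.mem_univ, true_and]
    exact ⟨by linarith, hbig i (by gcongr)⟩)
  have hX2 : dm ≤ X'.card := h4.trans (Finset.card_le_card fun i hi => by
    have hi' : γ i ≤ -c := by simpa using hi
    simp only [hX', Finset.mem_filter, Finset.mem_univ, true_and]
    exact ⟨by linarith, hbig i (by nlinarith)⟩)
  have hd1 : Disjoint X X' := by
    rw [Finset.disjoint_left]
    intro i hi hi'
    simp only [hX, hX', Finset.mem_filter, Finset.mem_univ, true_and] at hi hi'
    linarith [hi.1, hi'.1]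
  have hd2 : Disjoint (X ∪ X') Z := by
    rw [Finset.disjoint_left]
    intro i hi hi'
    simp only [hX, hX', hZ, Finset.mem_union, Finset.mem_filter, Finset.mem_univ,
      true_and] at hi hi'
    have : ∃ k : Fin p, d₀ ≤ (k : ℕ) ∧ γ i ^ 2 = γ2 k := by
      rcases hi with hi | hi <;> exact hi.2
    obtain ⟨k, hk, hk'⟩ := this
    have := h2 k hk
    linarith
  -- Three disjoint sets have at least `dp`, `dm` and `d₀` elements; these numbers add up to `p`, so
  -- each count is exact.
  have hsum : X.card + X'.card + Z.card ≤ p := by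
    rw [← Finset.card_union_of_disjoint hd1, ← Finset.card_union_of_disjoint hd2]
    simpa using Finset.card_le_univ ((X ∪ X') ∪ Z)
  have h5 : d₀ ≤ Z.card := by convert h5
  omega

end

/-! ### The estimator on the event that the covariance estimators are accurate -/

section

variable {p : ℕ}

theorem mulVec_dotProduct_self_le {ι κ : Type*} [Fintype ι] [Fintype κ] (E : Matrix ι κ ℝ)
    (w : κ → ℝ) : (E *ᵥ w) ⬝ᵥ (E *ᵥ w) ≤ (∑ i, ∑ j, E i j ^ 2) * (w ⬝ᵥ w) := by
  rw [dotProduct_self_eq_sum_sq, dotProduct_self_eq_sum_sq, Finset.sum_mul]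
  exact Finset.sum_le_sum fun i _ => Finset.sum_mul_sq_le_sq_mul_sq _ _ _

theorem mulVec_dotProduct_self_le_of_entry_le {E : Matrix (Fin p) (Fin p) ℝ} {δ : ℝ}
    (hE : ∀ i j, |E i j| ≤ δ) (w : Fin p → ℝ) :
    (E *ᵥ w) ⬝ᵥ (E *ᵥ w) ≤ (p * δ) ^ 2 * (w ⬝ᵥ w) := by
  refine (mulVec_dotProduct_self_le E w).trans
    (mul_le_mul_of_nonneg_right ?_ (dotProduct_self_nonneg' w))
  calc ∑ i, ∑ j, E i j ^ 2 ≤ ∑ _i : Fin p, ∑ _j : Fin p, δ ^ 2 :=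
        Finset.sum_le_sum fun i _ => Finset.sum_le_sum fun j _ => by
          rw [← sq_abs]; exact pow_le_pow_left₀ (abs_nonneg _) (hE i j) 2
    _ = (p * δ) ^ 2 := by simp; ring

theorem exists_pos_le_abs_of_ne_zero (μ : Fin p → ℝ) :
    ∃ m > 0, ∀ i, μ i ≠ 0 → m ≤ |μ i| := by
  by_cases h : (Finset.univ.filter fun i => μ i ≠ 0).Nonempty
  · obtain ⟨i, hi, hmin⟩ := Finset.exists_min_image _ (fun i => |μ i|) h
    refine ⟨|μ i|, abs_pos.mpr (by simpa using hi), fun j hj => hmin j (by simpa using hj)⟩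
  · refine ⟨1, one_pos, fun i hi => absurd ⟨i, by simpa using hi⟩ h⟩

theorem cfc_sqrt_mul_self {S : Matrix (Fin p) (Fin p) ℝ} (hS : S.PosSemidef) :
    cfc Real.sqrt S * cfc Real.sqrt S = S := by
  have hsa : IsSelfAdjoint S := hS.isHermitian
  rw [← cfc_mul Real.sqrt Real.sqrt S]
  conv_rhs => rw [← cfc_id ℝ S]
  refine cfc_congr fun x hx => ?_
  rw [hS.isHermitian.spectrum_real_eq_range_eigenvalues] at hx
  obtain ⟨i, rfl⟩ := hx
  exact Real.mul_self_sqrt (hS.eigenvalues_nonneg i)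

theorem ascEigenvalue_nonneg {B : Matrix (Fin p) (Fin p) ℝ} (hB : B.IsHermitian)
    (hpsd : B.PosSemidef) (k : Fin p) : 0 ≤ ascEigenvalue hB k := by
  have h := hpsd.eigenvalues_nonneg
    (Fintype.equivOfCardEq (Fintype.card_fin _) (Fin.cast (Fintype.card_fin p).symm k.rev))
  rwa [IsHermitian.eigenvalues, Equiv.symm_apply_apply] at h

theorem transpose_cfc (f : ℝ → ℝ) (S : Matrix (Fin p) (Fin p) ℝ) : (cfc f S)ᵀ = cfc f S := by
  have : IsSelfAdjoint (cfc f S) := cfc_predicate f S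
  rw [← conjTranspose_eq_transpose_of_trivial]
  exact this

/-- The estimator agrees with the pseudo nullity as soon as the two covariance estimators are close
to their targets and the critical values lie in the gap of the test statistic. -/
theorem exists_dHat_eq_pseudoNullity {S M : Matrix (Fin p) (Fin p) ℝ} {a₀ : ℝ} (ha₀ : 0 < a₀)
    (hS : ∀ w, a₀ * (w ⬝ᵥ w) ≤ w ⬝ᵥ (S *ᵥ w)) (hM : M.IsHermitian) :
    ∃ ε > 0, ∃ c > 0, ∃ C ≥ 0, ∀ (K : ℝ → ℝ) (h m4 α u : ℝ) (T : ℕ) (x : ℕ → Fin p → ℝ) (δ : ℝ),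
      0 ≤ δ → δ ≤ ε → (∀ i j, |(estA2 K h u T x - S) i j| ≤ δ) →
      (∀ i j, |(estM K h u T x - M) i j| ≤ δ) →
      0 ≤ T * h / ((∫ v, K v ^ 2) * m4) →
      (∀ r, 1 ≤ r → r ≤ p →
        T * h / ((∫ v, K v ^ 2) * m4) * (C * δ ^ 2) ≤ chiSqCrit (r * (r + 1) / 2) α) →
      (∀ r, 1 ≤ r → r ≤ p →
        chiSqCrit (r * (r + 1) / 2) α < T * h / ((∫ v, K v ^ 2) * m4) * c) →
      dHat K h m4 α u T x = pseudoNullity M := by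
  obtain ⟨R, hR', hR, hMR⟩ := exists_orthogonal_diagonalization hM
  set μ := ascEigenvalue hM
  obtain ⟨m, hm, hμ⟩ := exists_pos_le_abs_of_ne_zero μ
  set a := a₀ / 2 with ha_def
  have ha : 0 < a := by positivity
  set b := √(∑ i, ∑ j, S i j ^ 2) + a with hb_def
  have hb : 0 < b := by positivity
  set c := m / (2 * b) with hc_def
  have hc : 0 < c := by positivity
  have hSup : ∀ w, w ⬝ᵥ (S *ᵥ w) ≤ √(∑ i, ∑ j, S i j ^ 2) * (w ⬝ᵥ w) := fun w =>
    (le_abs_self _).trans (abs_dotProduct_le (Real.sqrt_nonneg _) (by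
      rw [Real.sq_sqrt (by positivity)]
      exact mulVec_dotProduct_self_le S w))
  -- An entrywise error `δ` is an operator error `p δ`; dividing by `p + 1` also covers `p = 0`. The
  -- bound `a` keeps the estimated covariance `≥ a`, `m/2` preserves the gap, and `a c / 2` makes
  -- `(p δ / a)² < c²`. The last constant bounds a sum of at most `p` small eigenvalues.
  refine ⟨min (min a (m / 2)) (a * c / 2) / (p + 1), by positivity, c ^ 2, by positivity,
    p * (p / a) ^ 2, by positivity, ?_⟩
  intro K h m4 α u T x δ hδ0 hδ hSh hMh hκ hlow hupp
  set κ := T * h / ((∫ v, K v ^ 2) * m4)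
  rw [le_div_iff₀ (by positivity)] at hδ
  have hpδ : p * δ ≤ min (min a (m / 2)) (a * c / 2) := by nlinarith
  have hpδ0 : 0 ≤ p * δ := by positivity
  have hpa : p * δ ≤ a := hpδ.trans ((min_le_left _ _).trans (min_le_left _ _))
  have hpm : p * δ ≤ m / 2 := hpδ.trans ((min_le_left _ _).trans (min_le_right _ _))
  have hpc : p * δ ≤ a * c / 2 := hpδ.trans (min_le_right _ _)
  set Sh := estA2 K h u T x with hSh_def
  have hShH : Sh.IsHermitian := weightedCov_isHermitian _ T x
  have hErr : ∀ w, |w ⬝ᵥ ((Sh - S) *ᵥ w)| ≤ a * (w ⬝ᵥ w) := fun w =>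
    (abs_dotProduct_le hpδ0 (mulVec_dotProduct_self_le_of_entry_le hSh w)).trans
      (mul_le_mul_of_nonneg_right hpa (dotProduct_self_nonneg' w))
  have hShS : ∀ w, w ⬝ᵥ (Sh *ᵥ w) = w ⬝ᵥ (S *ᵥ w) + w ⬝ᵥ ((Sh - S) *ᵥ w) := fun w => by
    rw [sub_mulVec, dotProduct_sub]; ring
  have hlowSh : ∀ w, a * (w ⬝ᵥ w) ≤ w ⬝ᵥ (Sh *ᵥ w) := fun w => by
    have h1 := (abs_le.mp (hErr w)).1
    have h2 := hS w
    have h3 : a₀ = 2 * a := by rw [ha_def]; ring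
    rw [hShS]; rw [h3] at h2; linarith
  have hupSh : ∀ w, w ⬝ᵥ (Sh *ᵥ w) ≤ b * (w ⬝ᵥ w) := fun w => by
    have h1 := (abs_le.mp (hErr w)).2
    have h2 := hSup w
    rw [hShS, hb_def]; linarith
  have hpsd : Sh.PosSemidef := by
    refine PosSemidef.of_dotProduct_mulVec_nonneg hShH fun w => ?_
    rw [star_trivial]
    exact (mul_nonneg ha.le (dotProduct_self_nonneg' w)).trans (hlowSh w)
  set N := cfc Real.sqrt Sh with hN_def
  have hNN : N * N = Sh := cfc_sqrt_mul_self hpsd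
  have hNt : Nᵀ = N := transpose_cfc _ _
  have hNw : ∀ w, (N *ᵥ w) ⬝ᵥ (N *ᵥ w) = w ⬝ᵥ (Sh *ᵥ w) := fun w => by
    rw [dotProduct_transpose_mulVec, hNt, mulVec_mulVec, hNN]
  have hNunit : IsUnit N := by
    rw [← mulVec_injective_iff_isUnit]
    intro x y hxy
    have h1 : N *ᵥ (x - y) = 0 := by rw [mulVec_sub]; exact sub_eq_zero.mpr hxy
    have h2 := hlowSh (x - y)
    rw [← hNw, h1, dotProduct_zero] at h2
    have h3 : (x - y) ⬝ᵥ (x - y) = 0 :=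
      le_antisymm (by nlinarith) (dotProduct_self_nonneg' _)
    exact sub_eq_zero.mp (dotProduct_self_eq_zero.mp h3)
  have hNF : N * N⁻¹ = 1 := mul_nonsing_inv N ((isUnit_iff_isUnit_det N).mp hNunit)
  obtain ⟨g1, g2, g3, g4, g5⟩ := eigenvalue_gap hNt hNF ha hb
    (fun w => by rw [hNw]; exact hlowSh w) (fun w => by rw [hNw]; exact hupSh w)
    (mulVec_dotProduct_self_le_of_entry_le hMh) hpδ0 hpm hm hR' hMR hμ
    (estB_isHermitian K h u T x)
  set d₀ := (Finset.univ.filter fun i => μ i = 0).card with hd₀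
  have hgap : (p * δ) ^ 2 / a ^ 2 < c ^ 2 := by
    rw [← div_pow]
    have : p * δ / a < c := by
      rw [div_lt_iff₀ ha]; nlinarith [mul_pos ha hc]
    exact pow_lt_pow_left₀ this (by positivity) two_ne_zero
  have hsum := card_neg_add_card_zero_add_card_pos μ
  have hcount := card_signed_eq (fun i => sq_ascEigenvalue_mem_range (estB_isHermitian K h u T x) i)
    hc hgap hsum g1 g2 g3 g4 g5
  have hnonneg : ∀ k, 0 ≤ gammaHat2 K h u T x k := by
    intro k
    refine ascEigenvalue_nonneg _ ?_ k
    have h1 := posSemidef_conjTranspose_mul_self (estB K h u T x)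
    rwa [(estB_isHermitian K h u T x).eq, ← sq] at h1
  have hd₀p : d₀ ≤ p := by omega
  have hd0 : d0Hat K h m4 α u T x = d₀ := by
    classical
    unfold d0Hat
    rw [Nat.findGreatest_eq_iff]
    -- Zero is the default of `Nat.findGreatest`, so critical values matter only for `r ≥ 1`.
    refine ⟨hd₀p, fun hne => ?_, fun r hr hrp => ?_⟩
    · refine le_trans ?_ (hlow d₀ (Nat.one_le_iff_ne_zero.mpr hne) hd₀p)
      unfold minchi2
      refine mul_le_mul_of_nonneg_left ?_ hκ
      calc ∑ i ∈ Finset.univ.filter (fun i : Fin p => (i : ℕ) < d₀), gammaHat2 K h u T x i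
          ≤ ∑ i ∈ Finset.univ.filter (fun i : Fin p => (i : ℕ) < d₀), (p * δ) ^ 2 / a ^ 2 :=
            Finset.sum_le_sum fun i hi => g1 i (by simpa using hi)
        _ ≤ ∑ i : Fin p, (p * δ) ^ 2 / a ^ 2 :=
            Finset.sum_le_sum_of_subset_of_nonneg (Finset.filter_subset _ _)
              fun _ _ _ => by positivity
        _ = p * (p / a) ^ 2 * δ ^ 2 := by simp; ring
    · rw [not_le]
      refine (hupp r (by omega) hrp).trans_le ?_
      unfold minchi2
      refine mul_le_mul_of_nonneg_left ?_ hκ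
      -- In zero-based indexing the first large eigenvalue has index `d₀`, and every sum with `r >
      -- d₀` contains it.
      refine (g2 ⟨d₀, by omega⟩ le_rfl).trans ?_
      exact Finset.single_le_sum (f := fun i => gammaHat2 K h u T x i) (fun i _ => hnonneg i)
        (by simpa using hr)
  have hplus : dPlusHat K h m4 α u T x = (Finset.univ.filter fun i => 0 < μ i).card := by
    rw [← hcount.1]
    unfold dPlusHat
    rw [hd0]
    rfl
  have hminus : dMinusHat K h m4 α u T x = (Finset.univ.filter fun i => μ i < 0).card := by
    rw [← hcount.2]
    unfold dMinusHat
    rw [hd0]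
    rfl
  rw [dHat, hd0, hplus, hminus, pseudoNullity_eq hR hR' hMR]

end

/-! ### Size of the chi-square critical values -/

section

/-- Chernoff's bound with parameters `√c` and `-√c` for the two tails; each exponent is `-c + c/2`.
-/
theorem gaussianReal_sq_gt_le {c : ℝ} (hc : 0 ≤ c) :
    (gaussianReal 0 1).real {x | c < x ^ 2} ≤ 2 * Real.exp (-c / 2) := by
  have hexp : ∀ t : ℝ, Integrable (fun x => Real.exp (t * id x)) (gaussianReal 0 1) :=
    fun t => integrable_exp_mul_gaussianReal t
  have hs : √c ^ 2 = c := Real.sq_sqrt hc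
  have h1 := measure_ge_le_exp_mul_mgf (X := id) √c (Real.sqrt_nonneg c) (hexp √c)
  have h2 := measure_le_le_exp_mul_mgf (X := id) (-√c) (neg_nonpos.mpr (Real.sqrt_nonneg c))
    (hexp (-√c))
  rw [mgf_id_gaussianReal] at h1 h2
  have e1 : Real.exp (-√c * √c) * Real.exp (0 * √c + ((1 : NNReal) : ℝ) * √c ^ 2 / 2) =
      Real.exp (-c / 2) := by
    rw [← Real.exp_add]; congr 1; push_cast; nlinarith
  have e2 : Real.exp (- -√c * -√c) * Real.exp (0 * -√c + ((1 : NNReal) : ℝ) * (-√c) ^ 2 / 2) =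
      Real.exp (-c / 2) := by
    rw [← Real.exp_add]; congr 1; push_cast; nlinarith
  simp only [] at h1 h2
  rw [e1] at h1
  rw [e2] at h2
  calc (gaussianReal 0 1).real {x | c < x ^ 2}
      ≤ (gaussianReal 0 1).real ({x | √c ≤ id x} ∪ {x | id x ≤ -√c}) := by
        refine measureReal_mono fun x hx => ?_
        have hx' : c < x ^ 2 := hx
        rcases le_total 0 x with h | h
        · exact Or.inl (Real.sqrt_le_iff.mpr ⟨h, hx'.le⟩)
        · right
          have : √c ≤ -x := Real.sqrt_le_iff.mpr ⟨by linarith, by nlinarith⟩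
          show x ≤ -√c
          linarith
    _ ≤ _ := (measureReal_union_le _ _).trans (by linarith)

theorem measurable_sum_sq (k : ℕ) : Measurable fun z : Fin k → ℝ => ∑ i, z i ^ 2 := by fun_prop

instance (k : ℕ) : IsProbabilityMeasure (chiSq k) := by
  unfold chiSq
  exact Measure.isProbabilityMeasure_map (measurable_sum_sq k).aemeasurable

theorem pi_gaussianReal_real_eval (k : ℕ) (i : Fin k) {s : Set ℝ} (hs : MeasurableSet s) :
    (Measure.pi fun _ : Fin k => gaussianReal 0 1).real {z | z i ∈ s} =
      (gaussianReal 0 1).real s := by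
  have h := measurePreserving_eval (fun _ : Fin k => gaussianReal 0 1) i
  simp only [measureReal_def]
  rw [← h.measure_preimage hs.nullMeasurableSet]
  rfl

theorem measurableSet_lt_sq (c : ℝ) : MeasurableSet {x : ℝ | c < x ^ 2} :=
  measurableSet_lt measurable_const (by fun_prop)

theorem chiSq_real_Ioi (k : ℕ) (c : ℝ) : (chiSq k).real (Set.Ioi c) =
    (Measure.pi fun _ : Fin k => gaussianReal 0 1).real {z | c < ∑ i, z i ^ 2} := by
  rw [chiSq, map_measureReal_apply (measurable_sum_sq k) measurableSet_Ioi]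
  rfl

theorem chiSq_real_Iic (k : ℕ) (c : ℝ) :
    (chiSq k).real (Set.Iic c) = 1 - (chiSq k).real (Set.Ioi c) := by
  rw [← Set.compl_Iic, probReal_compl_eq_one_sub measurableSet_Iic]; ring

/-- If `k` squares sum to more than `c`, one of them exceeds `c/k`; a union bound gives a cruder
rate than the true one, but an exponential one. -/
theorem chiSq_real_Ioi_le {k : ℕ} (hk : 0 < k) {c : ℝ} (hc : 0 ≤ c) :
    (chiSq k).real (Set.Ioi c) ≤ 2 * k * Real.exp (-c / (2 * k)) := by
  have hk' : (0 : ℝ) < k := by exact_mod_cast hk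
  rw [chiSq_real_Ioi]
  calc (Measure.pi fun _ : Fin k => gaussianReal 0 1).real {z | c < ∑ i, z i ^ 2}
      ≤ (Measure.pi fun _ : Fin k => gaussianReal 0 1).real
        (⋃ i, {z | z i ∈ {x : ℝ | c / k < x ^ 2}}) := by
        refine measureReal_mono fun z hz => ?_
        by_contra h
        simp only [Set.mem_iUnion, Set.mem_ofPred_eq, not_exists, not_lt] at h
        have : ∑ i, z i ^ 2 ≤ ∑ _i : Fin k, c / k := Finset.sum_le_sum fun i _ => h i
        rw [Finset.sum_const, Finset.card_univ, Fintype.card_fin, nsmul_eq_mul,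
          mul_div_cancel₀ _ hk'.ne'] at this
        exact absurd hz (not_lt.mpr this)
    _ ≤ ∑ i, (Measure.pi fun _ : Fin k => gaussianReal 0 1).real
        {z | z i ∈ {x : ℝ | c / k < x ^ 2}} := measureReal_iUnion_fintype_le _
    _ ≤ ∑ _i : Fin k, 2 * Real.exp (-(c / k) / 2) := Finset.sum_le_sum fun i _ => by
        rw [pi_gaussianReal_real_eval k i (measurableSet_lt_sq _)]
        exact gaussianReal_sq_gt_le (by positivity)
    _ = _ := by
        have : -(c / k) / 2 = -c / (2 * k) := by field_simp
        simp [this]; ring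

/-- Unbounded support is what drives the critical values to infinity. One coordinate suffices: its
square exceeds `c` on a half-line, which is not Gaussian-null. -/
theorem chiSq_real_Ioi_pos {k : ℕ} (hk : 0 < k) (c : ℝ) : 0 < (chiSq k).real (Set.Ioi c) := by
  rw [chiSq_real_Ioi]
  have h1 : (gaussianReal 0 1).real {x | c < x ^ 2} ≤
      (Measure.pi fun _ : Fin k => gaussianReal 0 1).real {z | c < ∑ i, z i ^ 2} := by
    rw [← pi_gaussianReal_real_eval k ⟨0, hk⟩ (measurableSet_lt_sq _)]
    refine measureReal_mono fun z hz => ?_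
    exact lt_of_lt_of_le hz
      (Finset.single_le_sum (f := fun i => z i ^ 2) (fun i _ => sq_nonneg _) (Finset.mem_univ _))
  refine lt_of_lt_of_le ?_ h1
  rw [measureReal_def, ENNReal.toReal_pos_iff]
  refine ⟨?_, measure_lt_top _ _⟩
  rw [pos_iff_ne_zero]
  intro h0
  have h2 : volume {x : ℝ | c < x ^ 2} = 0 :=
    gaussianReal_absolutelyContinuous' 0 one_ne_zero h0
  have h3 : Set.Ioi (max c 1) ⊆ {x : ℝ | c < x ^ 2} := fun x hx => by
    have h4 : max c 1 < x := hx
    have h5 := le_max_left c 1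
    have h6 := le_max_right c 1
    show c < x ^ 2
    nlinarith
  have h4 := measure_mono_null h3 h2
  simp at h4

/-- Bounds below the set whose `sInf` is the critical value; `α < 1` excludes points without mass to
their left. -/
theorem nonneg_of_mem_chiSqCrit_set {k : ℕ} {α c : ℝ} (hα : α < 1)
    (hc : 1 - α ≤ (chiSq k).real (Set.Iic c)) : 0 ≤ c := by
  by_contra! hneg
  have : (chiSq k).real (Set.Iic c) = 0 := by
    rw [chiSq, map_measureReal_apply (measurable_sum_sq k) measurableSet_Iic]
    have : (fun z : Fin k → ℝ => ∑ i, z i ^ 2) ⁻¹' Set.Iic c = ∅ := by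
      ext z
      simp only [Set.mem_preimage, Set.mem_Iic, Set.mem_empty_iff_false, iff_false, not_le]
      exact hneg.trans_le (Finset.sum_nonneg fun i _ => sq_nonneg _)
    rw [this, measureReal_empty]
  linarith

/-- At this point the exponential tail bound equals `α`. -/
theorem mem_chiSqCrit_set {k : ℕ} (hk : 0 < k) {α : ℝ} (hα : α ∈ Set.Ioo (0 : ℝ) 1) :
    1 - α ≤ (chiSq k).real (Set.Iic (2 * k * Real.log (2 * k / α))) := by
  have hk' : (1 : ℝ) ≤ k := by exact_mod_cast hk
  have hα0 := hα.1
  have h1 : (1 : ℝ) ≤ 2 * k / α := by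
    rw [le_div_iff₀ hα0]; linarith [hα.2]
  have h2 := chiSq_real_Ioi_le hk (c := 2 * k * Real.log (2 * k / α))
    (mul_nonneg (by positivity) (Real.log_nonneg h1))
  have h3 : -(2 * k * Real.log (2 * k / α)) / (2 * k) = - Real.log (2 * k / α) := by
    field_simp
  rw [h3, Real.exp_neg, Real.exp_log (by positivity)] at h2
  have h4 : 2 * (k : ℝ) * (2 * k / α)⁻¹ = α := by field_simp
  rw [chiSq_real_Iic]
  linarith

theorem chiSqCrit_le {k : ℕ} (hk : 0 < k) {α : ℝ} (hα : α ∈ Set.Ioo (0 : ℝ) 1) :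
    chiSqCrit k α ≤ 2 * k * Real.log (2 * k / α) :=
  csInf_le ⟨0, fun _ hc => nonneg_of_mem_chiSqCrit_set hα.2 hc⟩ (mem_chiSqCrit_set hk hα)

theorem le_chiSqCrit {k : ℕ} (hk : 0 < k) {α c : ℝ} (hα : α ∈ Set.Ioo (0 : ℝ) 1)
    (hαc : α < (chiSq k).real (Set.Ioi c)) : c ≤ chiSqCrit k α := by
  refine le_csInf ⟨_, mem_chiSqCrit_set hk hα⟩ fun x hx => ?_
  by_contra! hlt
  have h1 : (chiSq k).real (Set.Iic x) ≤ (chiSq k).real (Set.Iic c) :=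
    measureReal_mono (Set.Iic_subset_Iic.mpr hlt.le)
  rw [chiSq_real_Iic k c] at h1
  have hx' : 1 - α ≤ (chiSq k).real (Set.Iic x) := hx
  linarith

theorem tendsto_chiSqCrit_atTop {k : ℕ} (hk : 0 < k) {α : ℕ → ℝ}
    (hα : ∀ T, α T ∈ Set.Ioo (0 : ℝ) 1) (hα0 : Tendsto α atTop (𝓝 0)) :
    Tendsto (fun T => chiSqCrit k (α T)) atTop atTop := by
  rw [tendsto_atTop]
  intro c
  filter_upwards [hα0.eventually (gt_mem_nhds (chiSq_real_Ioi_pos hk c))] with T hT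
  exact le_chiSqCrit hk (hα T) hT

theorem eventually_chiSqCrit_lt {k : ℕ} (hk : 0 < k) {α s : ℕ → ℝ}
    (hα : ∀ T, α T ∈ Set.Ioo (0 : ℝ) 1) (hs : Tendsto s atTop atTop)
    (hαs : Tendsto (fun T => -Real.log (α T) / s T) atTop (𝓝 0)) {c : ℝ} (hc : 0 < c) :
    ∀ᶠ T in atTop, chiSqCrit k (α T) < c * s T := by
  have hk' : (0 : ℝ) < k := by exact_mod_cast hk
  have h1 : Tendsto (fun T => 2 * k * (Real.log (2 * k) / s T + -Real.log (α T) / s T)) atTop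
      (𝓝 (2 * k * (0 + 0))) :=
    ((hs.const_div_atTop _).add hαs).const_mul _
  have h2 : (2 * (k : ℝ) * (0 + 0)) < c := by simpa using hc
  filter_upwards [h1.eventually (gt_mem_nhds h2), hs.eventually_gt_atTop 0] with T hT hsT
  refine (chiSqCrit_le hk (hα T)).trans_lt ?_
  rw [Real.log_div (by positivity) (hα T).1.ne']
  rw [← add_div, ← mul_div_assoc, div_lt_iff₀ hsT] at hT
  linarith

end

/-! ### Riemann sums against kernels of bounded variation -/

section

/-- `W` is the signed variation from `0`. Its increments dominate those of `K` and telescope over a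
partition; the factor `2` in `V` allows `x` and `y` on opposite sides of `0`. -/
theorem exists_monotone_variation_bound {K : ℝ → ℝ} (hK : BoundedVariationOn K Set.univ) :
    ∃ (W : ℝ → ℝ) (V : ℝ), 0 ≤ V ∧ (∀ x y, W y - W x ≤ V) ∧
      (∀ x y, x ≤ y → |K y - K x| ≤ W y - W x) := by
  refine ⟨variationOnFromTo K Set.univ 0, 2 * (eVariationOn K Set.univ).toReal, by positivity,
    fun x y => ?_, fun x y hxy => ?_⟩
  · have h1 := abs_le.mp (variationOnFromTo.abs_le_eVariationOn hK (a := 0) (b := x))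
    have h2 := abs_le.mp (variationOnFromTo.abs_le_eVariationOn hK (a := 0) (b := y))
    linarith [h1.1, h2.2]
  · exact variationOnFromTo.abs_sub_le_sub_of_le hK.locallyBoundedVariationOn
      (Set.mem_univ _) (Set.mem_univ _) (Set.mem_univ _) hxy

theorem abs_cell_sub_integral_le {k g W : ℝ → ℝ} {a b G D : ℝ} (hab : a ≤ b)
    (hW : ∀ x y, x ≤ y → |k y - k x| ≤ W y - W x)
    (hk : IntervalIntegrable k volume a b)
    (hkg : IntervalIntegrable (fun v => k v * g v) volume a b)
    (hG : |g b| ≤ G) (hD : ∀ v ∈ Set.Ioo a b, |g b - g v| ≤ D) :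
    |(b - a) * (k b * g b) - ∫ v in a..b, k v * g v| ≤
      (b - a) * ((W b - W a) * G) + D * ∫ v in a..b, |k v| := by
  have hWmono : ∀ x y, x ≤ y → W x ≤ W y := fun x y hxy => by
    have := (abs_nonneg _).trans (hW x y hxy); linarith
  have h1 : (b - a) * (k b * g b) - ∫ v in a..b, k v * g v =
      ∫ v in a..b, (k b * g b - k v * g v) := by
    rw [intervalIntegral.integral_sub intervalIntegrable_const hkg]; simp; ring
  have h2 : (b - a) * ((W b - W a) * G) + D * ∫ v in a..b, |k v| =
      ∫ v in a..b, ((W b - W a) * G + D * |k v|) := by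
    rw [intervalIntegral.integral_add intervalIntegrable_const (hk.abs.const_mul D)]; simp; ring
  rw [h1, h2, ← Real.norm_eq_abs]
  refine (intervalIntegral.norm_integral_le_integral_norm hab).trans ?_
  refine intervalIntegral.integral_mono_on_of_le_Ioo hab
    (intervalIntegrable_const.sub hkg).norm
    (intervalIntegrable_const.add (hk.abs.const_mul D)) fun v hv => ?_
  have e : k b * g b - k v * g v = (k b - k v) * g b + k v * (g b - g v) := by ring
  rw [Real.norm_eq_abs, e]
  refine (abs_add_le _ _).trans ?_
  rw [abs_mul, abs_mul, mul_comm D]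
  have h3 : |k b - k v| ≤ W b - W a :=
    (hW v b hv.2.le).trans (by linarith [hWmono a v hv.1.le])
  have h4 := hD v hv
  gcongr
  exact (abs_nonneg _).trans h3

/-- Over the cells, the oscillation of `k` telescopes to `V` and that of `g` is at most `L/T`. The
term `2κG` pays for the last cell, whose node `1` lies outside the interval where `g` is Lipschitz.
-/
theorem abs_riemann_sum_sub_integral_le {k g W : ℝ → ℝ} {V κ G L : ℝ}
    (hW : ∀ x y, x ≤ y → |k y - k x| ≤ W y - W x) (hV : ∀ x y, W y - W x ≤ V)
    (hκ : ∀ x, |k x| ≤ κ) (hk : IntegrableOn k (Set.Ioc 0 1))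
    (hG : ∀ v ∈ Set.Ioc (0 : ℝ) 1, |g v| ≤ G) (hL0 : 0 ≤ L)
    (hL : ∀ v ∈ Set.Ioo (0 : ℝ) 1, ∀ w ∈ Set.Ioo (0 : ℝ) 1, |g v - g w| ≤ L * |v - w|)
    {T : ℕ} (hT : 0 < T) :
    |(T : ℝ)⁻¹ * ∑ t ∈ Finset.Icc 1 T, k ((t : ℝ) / T) * g ((t : ℝ) / T) -
      ∫ v in Set.Ioo (0 : ℝ) 1, k v * g v| ≤
      (V * G + L * (∫ v in Set.Ioo (0 : ℝ) 1, |k v|) + 2 * κ * G) / T := by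
  have hT' : (0 : ℝ) < T := by exact_mod_cast hT
  have hG0 : 0 ≤ G := (abs_nonneg _).trans (hG 1 (by simp))
  have hgm : AEStronglyMeasurable g (volume.restrict (Set.Ioc 0 1)) := by
    have hc : ContinuousOn g (Set.Ioo 0 1) := by
      have : LipschitzOnWith L.toNNReal g (Set.Ioo 0 1) :=
        LipschitzOnWith.of_dist_le_mul fun v hv w hw => by
          rw [Real.dist_eq, Real.dist_eq, Real.coe_toNNReal _ hL0]; exact hL v hv w hw
      exact this.continuousOn
    rw [← Measure.restrict_congr_set (Ioo_ae_eq_Ioc (μ := volume))]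
    exact hc.aestronglyMeasurable measurableSet_Ioo
  have hkg : IntegrableOn (fun v => k v * g v) (Set.Ioc 0 1) := by
    refine Integrable.mul_bdd (c := G) hk hgm ?_
    exact (ae_restrict_iff' measurableSet_Ioc).mpr (ae_of_all _ fun v hv => hG v hv)
  let a : ℕ → ℝ := fun t => (t : ℝ) / T
  have ha_mono : Monotone a := fun s t hst => by simp only [a]; gcongr
  have ha0 : a 0 = 0 := by simp [a]
  have haT : a T = 1 := by simp [a, hT'.ne']
  have hsub : ∀ t < T, Set.uIoc (a t) (a (t + 1)) ⊆ Set.Ioc 0 1 := fun t ht => by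
    rw [Set.uIoc_of_le (ha_mono (Nat.le_succ t))]
    refine Set.Ioc_subset_Ioc ?_ ?_
    · rw [← ha0]; exact ha_mono (Nat.zero_le t)
    · rw [← haT]; exact ha_mono ht
  have hki : ∀ t < T, IntervalIntegrable k volume (a t) (a (t + 1)) := fun t ht =>
    intervalIntegrable_iff.mpr (hk.mono_set (hsub t ht))
  have hkgi : ∀ t < T, IntervalIntegrable (fun v => k v * g v) volume (a t) (a (t + 1)) :=
    fun t ht => intervalIntegrable_iff.mpr (hkg.mono_set (hsub t ht))
  have hstep : ∀ t, a (t + 1) - a t = (T : ℝ)⁻¹ := fun t => by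
    simp only [a]; push_cast; field_simp; ring
  have hcell : ∀ t ∈ Finset.range T,
      |(T : ℝ)⁻¹ * (k (a (t + 1)) * g (a (t + 1))) - ∫ v in a t..a (t + 1), k v * g v| ≤
      (T : ℝ)⁻¹ * ((W (a (t + 1)) - W (a t)) * G) +
        (L * (T : ℝ)⁻¹ * (∫ v in a t..a (t + 1), |k v|) +
          if t = T - 1 then 2 * κ * G * (T : ℝ)⁻¹ else 0) := by
    intro t ht
    have ht' := Finset.mem_range.mp ht
    have hmem : a (t + 1) ∈ Set.Ioc (0 : ℝ) 1 := by
      constructor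
      · simp only [a]; positivity
      · rw [← haT]; exact ha_mono ht'
    have hat0 : 0 ≤ a t := by simp only [a]; positivity
    have hle := ha_mono (Nat.le_succ t)
    have h1 := abs_cell_sub_integral_le (k := k) (g := g) (W := W) (G := G)
      (D := L * (T : ℝ)⁻¹ + if t = T - 1 then 2 * G else 0)
      hle hW (hki t ht') (hkgi t ht') (hG _ hmem) (by
        intro v hv
        have hv01 : v ∈ Set.Ioo (0 : ℝ) 1 := ⟨hat0.trans_lt hv.1, hv.2.trans_le hmem.2⟩
        split_ifs with hlast
        · have h2 := hG _ hmem
          have h3 := hG v ⟨hv01.1, hv01.2.le⟩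
          have h4 := abs_sub (g (a (t + 1))) (g v)
          have : 0 ≤ L * (T : ℝ)⁻¹ := by positivity
          linarith
        · have hlt : a (t + 1) < 1 := by
            simp only [a]
            rw [div_lt_one hT']
            exact_mod_cast (by omega : t + 1 < T)
          refine (hL _ ⟨hmem.1, hlt⟩ v hv01).trans ?_
          rw [add_zero]
          have hv2 : v < a (t + 1) := hv.2
          rw [abs_of_pos (by linarith)]
          have := hstep t
          have := hv.1
          gcongr
          linarith)
    rw [hstep] at h1
    refine h1.trans ?_
    rw [add_mul]
    gcongr
    split_ifs
    · have h2 : ∫ v in a t..a (t + 1), |k v| ≤ κ * (T : ℝ)⁻¹ := by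
        have h3 : ∫ v in a t..a (t + 1), |k v| ≤ ∫ v in a t..a (t + 1), κ :=
          intervalIntegral.integral_mono_on hle (hki t ht').abs intervalIntegrable_const
            fun v _ => hκ v
        rw [intervalIntegral.integral_const, hstep, smul_eq_mul, mul_comm] at h3
        exact h3
      have h4 : 2 * G * (∫ v in a t..a (t + 1), |k v|) ≤ 2 * G * (κ * (T : ℝ)⁻¹) := by gcongr
      linarith
    · simp
  have hI : ∫ v in Set.Ioo (0 : ℝ) 1, k v * g v =
      ∑ t ∈ Finset.range T, ∫ v in a t..a (t + 1), k v * g v := by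
    rw [intervalIntegral.sum_integral_adjacent_intervals hkgi, ha0, haT,
      intervalIntegral.integral_of_le zero_le_one, integral_Ioc_eq_integral_Ioo]
  have hI' : ∫ v in Set.Ioo (0 : ℝ) 1, |k v| =
      ∑ t ∈ Finset.range T, ∫ v in a t..a (t + 1), |k v| := by
    rw [intervalIntegral.sum_integral_adjacent_intervals fun t ht => (hki t ht).abs, ha0, haT,
      intervalIntegral.integral_of_le zero_le_one, integral_Ioc_eq_integral_Ioo]
  have hS : ∑ t ∈ Finset.Icc 1 T, k ((t : ℝ) / T) * g ((t : ℝ) / T) =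
      ∑ t ∈ Finset.range T, k (a (t + 1)) * g (a (t + 1)) := by
    rw [← Finset.Ico_add_one_right_eq_Icc, Finset.sum_Ico_eq_sum_range]
    simp only [add_tsub_cancel_right, a]
    exact Finset.sum_congr rfl fun t _ => by rw [add_comm 1 t]
  rw [hS, hI, Finset.mul_sum, ← Finset.sum_sub_distrib]
  refine (Finset.abs_sum_le_sum_abs _ _).trans ((Finset.sum_le_sum hcell).trans ?_)
  rw [Finset.sum_add_distrib, Finset.sum_add_distrib, ← Finset.mul_sum, ← Finset.mul_sum,
    ← Finset.sum_mul, Finset.sum_range_sub (fun t => W (a t)), ← hI', Finset.sum_ite_eq',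
    if_pos (Finset.mem_range.mpr (by omega))]
  have h5 : (W (a T) - W (a 0)) * G ≤ V * G := mul_le_mul_of_nonneg_right (hV _ _) hG0
  have h6 : (T : ℝ)⁻¹ * ((W (a T) - W (a 0)) * G) ≤ (T : ℝ)⁻¹ * (V * G) := by gcongr
  rw [div_eq_mul_inv]
  linarith

theorem IsKernel.exists_bound {K : ℝ → ℝ} (hK : IsKernel K) : ∃ κ ≥ 0, ∀ x, |K x| ≤ κ := by
  refine ⟨|K 0| + (eVariationOn K Set.univ).toReal, by positivity, fun x => ?_⟩
  have h1 := hK.boundedVariation.sub_le (Set.mem_univ x) (Set.mem_univ 0)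
  have h2 := hK.boundedVariation.sub_le (Set.mem_univ 0) (Set.mem_univ x)
  have h3 := le_abs_self (K 0)
  have h4 := neg_abs_le (K 0)
  rw [abs_le]
  constructor <;> linarith

/-- Otherwise `K` vanishes almost everywhere and cannot integrate to one. -/
theorem IsKernel.integral_sq_pos {K : ℝ → ℝ} (hK : IsKernel K) : 0 < ∫ v, K v ^ 2 := by
  obtain ⟨κ, hκ0, hκ⟩ := hK.exists_bound
  have hint : Integrable fun v => K v ^ 2 := by
    simp only [sq]
    exact Integrable.mul_bdd (c := κ) hK.integrable hK.integrable.aestronglyMeasurable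
      (ae_of_all _ hκ)
  rw [integral_pos_iff_support_of_nonneg (fun v => sq_nonneg _) hint, pos_iff_ne_zero]
  intro h0
  have h1 : K =ᵐ[volume] 0 := by
    rw [Filter.EventuallyEq, ae_iff]
    refine measure_mono_null (fun v hv => ?_) h0
    simp only [Function.mem_support]
    exact pow_ne_zero 2 hv
  have h2 := integral_congr_ae h1
  rw [hK.integral_eq_one] at h2
  simp at h2

theorem integral_comp_scale (f : ℝ → ℝ) {h : ℝ} (hh : 0 < h) (u : ℝ) :
    ∫ v, f (h⁻¹ * (v - u)) = h * ∫ v, f v := by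
  rw [integral_sub_right_eq_self (fun v => f (h⁻¹ * v)) u, Measure.integral_comp_mul_left,
    inv_inv, abs_of_pos hh, smul_eq_mul]

theorem integrable_comp_scale {f : ℝ → ℝ} (hf : Integrable f) {h : ℝ} (hh : 0 < h) (u : ℝ) :
    Integrable fun v => f (h⁻¹ * (v - u)) :=
  (hf.comp_mul_left' (inv_ne_zero hh.ne')).comp_sub_right u

/-- Evenness makes the argument increasing in `v`, as the comparison with the monotone `W` requires.
-/
theorem IsKernel.eval_scale {K : ℝ → ℝ} (hK : IsKernel K) (h u v : ℝ) : K (h⁻¹ * (u - v)) = K (h⁻¹ * (v - u)) := by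
  rw [← hK.even]; congr 1; ring

/-- The Riemann sum error, multiplied by `h⁻¹`, gives `1/T` and `1/(Th)`; replacing `g` by its value
at `u` costs `O(h)` by the first absolute moment. -/
theorem IsKernel.exists_bias_bound {K : ℝ → ℝ} (hK : IsKernel K) {u : ℝ} (hu : u ∈ Set.Ioo (0 : ℝ) 1) {g : ℝ → ℝ} {G L : ℝ}
    (hG : ∀ v ∈ Set.Ioc (0 : ℝ) 1, |g v| ≤ G) (hL0 : 0 ≤ L)
    (hL : ∀ v ∈ Set.Ioo (0 : ℝ) 1, ∀ w ∈ Set.Ioo (0 : ℝ) 1, |g v - g w| ≤ L * |v - w|) :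
    ∃ C ≥ 0, ∀ (h : ℝ) (T : ℕ), 0 < h → 0 < T →
      |(T : ℝ)⁻¹ * ∑ t ∈ Finset.Icc 1 T, h⁻¹ * K (h⁻¹ * (u - (t : ℝ) / T)) * g ((t : ℝ) / T) -
        g u| ≤ C * (h + (T : ℝ)⁻¹ + (T * h)⁻¹) := by
  obtain ⟨W, V, hV0, hWV, hW⟩ := exists_monotone_variation_bound hK.boundedVariation
  obtain ⟨κ, hκ0, hκ⟩ := hK.exists_bound
  have hG0 : 0 ≤ G := (abs_nonneg _).trans (hG 1 (by simp))
  set c := min u (1 - u) with hc_def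
  have hc : 0 < c := lt_min hu.1 (by linarith [hu.2])
  -- With this constant, `g` extended by zero is still Lipschitz at `u`: points outside `(0,1)` are
  -- at distance at least `c` from `u`, where the jump is at most `G`.
  set L' := L + G / c with hL'
  have hL'0 : 0 ≤ L' := by positivity
  set n1 := ∫ v, |K v| with hn1
  set m1 := ∫ v, |v * K v| with hm1
  have hn1' : 0 ≤ n1 := integral_nonneg fun _ => abs_nonneg _
  have hm1' : 0 ≤ m1 := integral_nonneg fun _ => abs_nonneg _
  refine ⟨L' * m1 + L * n1 + (V * G + 2 * κ * G), by positivity, fun h T hh hT => ?_⟩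
  have hT' : (0 : ℝ) < T := by exact_mod_cast hT
  set k : ℝ → ℝ := fun v => K (h⁻¹ * (v - u)) with hk_def
  have hkint : Integrable k := integrable_comp_scale hK.integrable hh u
  have hscale : ∀ x y, x ≤ y → h⁻¹ * (x - u) ≤ h⁻¹ * (y - u) := fun x y hxy => by gcongr
  have hR := abs_riemann_sum_sub_integral_le (k := k) (g := g) (W := fun v => W (h⁻¹ * (v - u)))
    (fun x y hxy => hW _ _ (hscale x y hxy)) (fun x y => hWV _ _) (fun x => hκ _)
    hkint.integrableOn hG hL0 hL hT
  have hkabs : ∫ v in Set.Ioo (0 : ℝ) 1, |k v| ≤ h * n1 := by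
    rw [hn1, ← integral_comp_scale (fun v => |K v|) hh u]
    exact setIntegral_le_integral hkint.abs (ae_of_all _ fun _ => abs_nonneg _)
  -- the localization error
  have hgm : AEStronglyMeasurable ((Set.Ioo (0 : ℝ) 1).indicator g) volume := by
    rw [aestronglyMeasurable_indicator_iff measurableSet_Ioo]
    have : LipschitzOnWith L.toNNReal g (Set.Ioo 0 1) :=
      LipschitzOnWith.of_dist_le_mul fun v hv w hw => by
        rw [Real.dist_eq, Real.dist_eq, Real.coe_toNNReal _ hL0]; exact hL v hv w hw
    exact this.continuousOn.aestronglyMeasurable measurableSet_Ioo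
  set gt := (Set.Ioo (0 : ℝ) 1).indicator g with hgt
  have hkgt : Integrable fun v => k v * gt v := by
    refine Integrable.mul_bdd (c := G) hkint hgm (ae_of_all _ fun v => ?_)
    by_cases hv : v ∈ Set.Ioo (0 : ℝ) 1
    · rw [hgt, Set.indicator_of_mem hv]; exact hG v ⟨hv.1, hv.2.le⟩
    · rw [hgt, Set.indicator_of_notMem hv, norm_zero]; exact hG0
  have hI : ∫ v in Set.Ioo (0 : ℝ) 1, k v * g v = ∫ v, k v * gt v := by
    rw [← integral_indicator measurableSet_Ioo]
    congr 1
    funext v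
    rw [hgt, Set.indicator_mul_right]
  have hgu : ∀ v, |gt v - g u| ≤ L' * |v - u| := by
    intro v
    by_cases hv : v ∈ Set.Ioo (0 : ℝ) 1
    · rw [hgt, Set.indicator_of_mem hv]
      refine (hL v hv u hu).trans (mul_le_mul_of_nonneg_right ?_ (abs_nonneg _))
      rw [hL']
      have : 0 ≤ G / c := by positivity
      linarith
    · rw [hgt, Set.indicator_of_notMem hv, zero_sub, abs_neg]
      have h1 : c ≤ |v - u| := by
        rw [Set.mem_Ioo, not_and_or, not_lt, not_lt] at hv
        rcases hv with hv | hv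
        · rw [abs_sub_comm]
          exact (min_le_left _ _).trans ((by linarith : u ≤ u - v).trans (le_abs_self _))
        · exact (min_le_right _ _).trans ((by linarith : 1 - u ≤ v - u).trans (le_abs_self _))
      calc |g u| ≤ G := hG u ⟨hu.1, hu.2.le⟩
        _ = G / c * c := by field_simp
        _ ≤ L' * |v - u| := by
          rw [hL']
          have : G / c ≤ L + G / c := by linarith
          gcongr
  have hmom : Integrable fun v => |v - u| * |k v| := by
    have := (integrable_comp_scale hK.first_moment.abs hh u).const_mul h
    refine this.congr (ae_of_all _ fun v => ?_)
    simp only [hk_def, abs_mul, abs_inv, abs_of_pos hh]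
    field_simp
  have hmom_eq : ∫ v, |v - u| * |k v| = h * (h * m1) := by
    rw [hm1, ← integral_comp_scale (fun v => |v * K v|) hh u, ← integral_const_mul]
    congr 1
    funext v
    simp only [hk_def, abs_mul, abs_inv, abs_of_pos hh]
    field_simp
  have hloc : |(∫ v in Set.Ioo (0 : ℝ) 1, k v * g v) - h * g u| ≤ L' * (h * (h * m1)) := by
    have h1 : (∫ v in Set.Ioo (0 : ℝ) 1, k v * g v) - h * g u = ∫ v, k v * (gt v - g u) := by
      rw [hI]
      simp only [mul_sub]
      rw [integral_sub hkgt (hkint.mul_const _), integral_mul_const,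
        integral_comp_scale K hh u, hK.integral_eq_one, mul_one]
    rw [h1, ← hmom_eq, ← integral_const_mul, ← Real.norm_eq_abs]
    refine norm_integral_le_of_norm_le (hmom.const_mul L') (ae_of_all _ fun v => ?_)
    rw [Real.norm_eq_abs, abs_mul]
    have := mul_le_mul_of_nonneg_left (hgu v) (abs_nonneg (k v))
    linarith
  have hsum : (T : ℝ)⁻¹ * ∑ t ∈ Finset.Icc 1 T,
      h⁻¹ * K (h⁻¹ * (u - (t : ℝ) / T)) * g ((t : ℝ) / T) =
      h⁻¹ * ((T : ℝ)⁻¹ * ∑ t ∈ Finset.Icc 1 T, k ((t : ℝ) / T) * g ((t : ℝ) / T)) := by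
    rw [mul_left_comm, Finset.mul_sum (Finset.Icc 1 T) _ h⁻¹]
    congr 1
    refine Finset.sum_congr rfl fun t _ => ?_
    rw [hK.eval_scale, mul_assoc]
  set S := (T : ℝ)⁻¹ * ∑ t ∈ Finset.Icc 1 T, k ((t : ℝ) / T) * g ((t : ℝ) / T)
  set I := ∫ v in Set.Ioo (0 : ℝ) 1, k v * g v
  have htot : |S - h * g u| ≤ (V * G + L * (h * n1) + 2 * κ * G) / T + L' * (h * (h * m1)) := by
    have h1 : S - h * g u = (S - I) + (I - h * g u) := by ring
    rw [h1]
    refine (abs_add_le _ _).trans (add_le_add (hR.trans ?_) hloc)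
    gcongr
  have e : h⁻¹ * S - g u = h⁻¹ * (S - h * g u) := by field_simp
  rw [hsum, e, abs_mul, abs_of_pos (inv_pos.mpr hh)]
  calc h⁻¹ * |S - h * g u|
      ≤ h⁻¹ * ((V * G + L * (h * n1) + 2 * κ * G) / T + L' * (h * (h * m1))) := by gcongr
    _ = L' * m1 * h + L * n1 * (T : ℝ)⁻¹ + (V * G + 2 * κ * G) * (T * h)⁻¹ := by
      field_simp; ring
    _ ≤ _ := by
      have a1 : 0 ≤ L' * m1 := by positivity
      have a2 : 0 ≤ L * n1 := by positivity
      have a3 : 0 ≤ V * G + 2 * κ * G := by positivity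
      have b1 : 0 ≤ (T : ℝ)⁻¹ := by positivity
      have b2 : 0 ≤ (T * h)⁻¹ := by positivity
      nlinarith [mul_nonneg a1 b1, mul_nonneg a1 b2, mul_nonneg a2 b2, mul_nonneg a2 hh.le,
        mul_nonneg a3 b1, mul_nonneg a3 hh.le]

/-- Since `K² ≤ κ|K|`, a Riemann sum of `|K|` suffices, and taking absolute values does not increase
the variation. -/
theorem IsKernel.exists_sum_sq_bound {K : ℝ → ℝ} (hK : IsKernel K) (u : ℝ) :
    ∃ C ≥ 0, ∀ (h : ℝ) (T : ℕ), 0 < h → 0 < T →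
      (T : ℝ)⁻¹ ^ 2 * ∑ t ∈ Finset.Icc 1 T, (h⁻¹ * K (h⁻¹ * (u - (t : ℝ) / T))) ^ 2 ≤
        C * ((T * h)⁻¹ * (1 + (T * h)⁻¹)) := by
  obtain ⟨W, V, hV0, hWV, hW⟩ := exists_monotone_variation_bound hK.boundedVariation
  obtain ⟨κ, hκ0, hκ⟩ := hK.exists_bound
  set n1 := ∫ v, |K v| with hn1
  have hn1' : 0 ≤ n1 := integral_nonneg fun _ => abs_nonneg _
  refine ⟨κ * (n1 + (V + 2 * κ)), by positivity, fun h T hh hT => ?_⟩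
  have hT' : (0 : ℝ) < T := by exact_mod_cast hT
  set k : ℝ → ℝ := fun v => |K (h⁻¹ * (v - u))| with hk_def
  have hkint : Integrable k := (integrable_comp_scale hK.integrable hh u).abs
  have hscale : ∀ x y, x ≤ y → h⁻¹ * (x - u) ≤ h⁻¹ * (y - u) := fun x y hxy => by gcongr
  have hR := abs_riemann_sum_sub_integral_le (k := k) (g := fun _ => 1) (G := 1) (L := 0)
    (W := fun v => W (h⁻¹ * (v - u)))
    (fun x y hxy => (abs_abs_sub_abs_le_abs_sub _ _).trans (hW _ _ (hscale x y hxy)))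
    (fun x y => hWV _ _) (fun x => by rw [hk_def]; simpa using hκ _)
    hkint.integrableOn (by simp) le_rfl (by simp) hT
  have hkabs : ∫ v in Set.Ioo (0 : ℝ) 1, k v ≤ h * n1 := by
    rw [hn1, ← integral_comp_scale (fun v => |K v|) hh u]
    exact setIntegral_le_integral hkint (ae_of_all _ fun _ => abs_nonneg _)
  simp only [mul_one, zero_mul, add_zero] at hR
  have hS : (T : ℝ)⁻¹ * ∑ t ∈ Finset.Icc 1 T, k ((t : ℝ) / T) ≤ h * n1 + (V + 2 * κ) / T := by
    have := (abs_le.mp hR).2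
    linarith
  have hterm : ∑ t ∈ Finset.Icc 1 T, (h⁻¹ * K (h⁻¹ * (u - (t : ℝ) / T))) ^ 2 ≤
      h⁻¹ ^ 2 * κ * ∑ t ∈ Finset.Icc 1 T, k ((t : ℝ) / T) := by
    rw [Finset.mul_sum]
    refine Finset.sum_le_sum fun t _ => ?_
    rw [hK.eval_scale, mul_pow, mul_assoc, ← sq_abs (K _)]
    have := mul_le_mul_of_nonneg_right (hκ (h⁻¹ * ((t : ℝ) / T - u))) (abs_nonneg (K (h⁻¹ * ((t : ℝ) / T - u))))
    rw [← sq] at this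
    gcongr
  calc (T : ℝ)⁻¹ ^ 2 * ∑ t ∈ Finset.Icc 1 T, (h⁻¹ * K (h⁻¹ * (u - (t : ℝ) / T))) ^ 2
      ≤ (T : ℝ)⁻¹ ^ 2 * (h⁻¹ ^ 2 * κ * ∑ t ∈ Finset.Icc 1 T, k ((t : ℝ) / T)) := by gcongr
    _ = (T : ℝ)⁻¹ * h⁻¹ ^ 2 * κ * ((T : ℝ)⁻¹ * ∑ t ∈ Finset.Icc 1 T, k ((t : ℝ) / T)) := by ring
    _ ≤ (T : ℝ)⁻¹ * h⁻¹ ^ 2 * κ * (h * n1 + (V + 2 * κ) / T) := by gcongr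
    _ = κ * ((T * h)⁻¹ * (n1 + (V + 2 * κ) * (T * h)⁻¹)) := by field_simp
    _ ≤ _ := by
      have b2 : 0 ≤ (T * h)⁻¹ := by positivity
      rw [mul_assoc κ]
      refine mul_le_mul_of_nonneg_left ?_ hκ0
      rw [mul_left_comm]
      refine mul_le_mul_of_nonneg_left ?_ b2
      nlinarith [mul_nonneg hn1' b2]

end

/-! ### Moments of the noise and Chebyshev's inequality -/

section

variable {p : ℕ} {Ω : Type*} [MeasurableSpace Ω] {P : Measure Ω}
  {ν : Measure ℝ} {Y : ℕ → Fin p → Ω → ℝ}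

/-- The cross products of the coordinates of `B y`. -/
def crossProd (B : Matrix (Fin p) (Fin p) ℝ) (i j : Fin p) (y : Fin p → ℝ) : ℝ :=
  (B *ᵥ y) i * (B *ᵥ y) j

theorem crossProd_eq_sum (B : Matrix (Fin p) (Fin p) ℝ) (i j : Fin p) (y : Fin p → ℝ) :
    crossProd B i j y = ∑ k, ∑ l, B i k * B j l * (y k * y l) := by
  simp only [crossProd, mulVec, dotProduct]
  rw [Finset.sum_mul_sum]
  exact Finset.sum_congr rfl fun k _ => Finset.sum_congr rfl fun l _ => by ring

theorem measurable_crossProd (B : Matrix (Fin p) (Fin p) ℝ) (i j : Fin p) :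
    Measurable (crossProd B i j) := by
  have : crossProd B i j = fun y => ∑ k, ∑ l, B i k * B j l * (y k * y l) :=
    funext (crossProd_eq_sum B i j)
  rw [this]
  fun_prop

/-- Two applications of Cauchy–Schwarz reduce the second moment to fourth moments of single
coordinates, so no mixed moments occur. -/
theorem sq_crossProd_le {B : Matrix (Fin p) (Fin p) ℝ} {a : ℝ} (hB : ∀ i j, |B i j| ≤ a)
    (i j : Fin p) (y : Fin p → ℝ) : crossProd B i j y ^ 2 ≤ a ^ 4 * p ^ 3 * ∑ k, y k ^ 4 := by
  have h1 : ∀ i, (B *ᵥ y) i ^ 2 ≤ p * a ^ 2 * ∑ k, y k ^ 2 := by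
    intro i
    have h0 : (B *ᵥ y) i ^ 2 ≤ (∑ k, B i k ^ 2) * ∑ k, y k ^ 2 := by
      simpa [mulVec, dotProduct] using Finset.sum_mul_sq_le_sq_mul_sq Finset.univ (B i) y
    refine h0.trans ?_
    refine mul_le_mul_of_nonneg_right ?_ (by positivity)
    calc ∑ k, B i k ^ 2 ≤ ∑ _k : Fin p, a ^ 2 := Finset.sum_le_sum fun k _ => by
          rw [← sq_abs]; exact pow_le_pow_left₀ (abs_nonneg _) (hB i k) 2
      _ = p * a ^ 2 := by simp
  have h2 : (∑ k, y k ^ 2) ^ 2 ≤ p * ∑ k, y k ^ 4 := by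
    have h := sq_sum_le_card_mul_sum_sq (α := ℝ) (s := (Finset.univ : Finset (Fin p)))
      (f := fun k => y k ^ 2)
    simpa [← pow_mul] using h
  calc crossProd B i j y ^ 2 = (B *ᵥ y) i ^ 2 * (B *ᵥ y) j ^ 2 := by rw [crossProd, mul_pow]
    _ ≤ (p * a ^ 2 * ∑ k, y k ^ 2) * (p * a ^ 2 * ∑ k, y k ^ 2) := by
        have := h1 i; have := h1 j; gcongr
    _ = p ^ 2 * a ^ 4 * (∑ k, y k ^ 2) ^ 2 := by ring
    _ ≤ p ^ 2 * a ^ 4 * (p * ∑ k, y k ^ 4) := by gcongr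
    _ = _ := by ring

theorem IsIIDNoise.aemeasurable (hY : IsIIDNoise P ν Y) (t : ℕ) (i : Fin p) :
    AEMeasurable (Y t i) P := (hY.law t i).aemeasurable

theorem IsIIDNoise.integral_comp (hY : IsIIDNoise P ν Y) (t : ℕ) (i : Fin p) {f : ℝ → ℝ}
    (hf : Measurable f) : ∫ ω, f (Y t i ω) ∂P = ∫ x, f x ∂ν :=
  (hY.law t i).integral_comp hf.aestronglyMeasurable

theorem IsIIDNoise.integrable_pow_four (hY : IsIIDNoise P ν Y) (t : ℕ) (i : Fin p) :
    Integrable (fun ω => Y t i ω ^ 4) P := by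
  have h := hY.fourth_moment
  rw [← (hY.law t i).map_eq] at h
  exact h.comp_aemeasurable (hY.aemeasurable t i)

theorem IsIIDNoise.memLp_two [IsProbabilityMeasure P] (hY : IsIIDNoise P ν Y) (t : ℕ) (i : Fin p) :
    MemLp (Y t i) 2 P := by
  rw [memLp_two_iff_integrable_sq (hY.aemeasurable t i).aestronglyMeasurable]
  refine ((hY.integrable_pow_four t i).add (integrable_const 1)).mono'
    ((hY.aemeasurable t i).pow_const 2).aestronglyMeasurable (ae_of_all _ fun ω => ?_)
  rw [Real.norm_eq_abs, abs_of_nonneg (sq_nonneg _)]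
  simp only [Pi.add_apply]
  nlinarith [sq_nonneg (Y t i ω ^ 2 - 1), sq_nonneg (Y t i ω ^ 2)]

theorem IsIIDNoise.integrable_mul [IsProbabilityMeasure P] (hY : IsIIDNoise P ν Y) (t : ℕ) (k l : Fin p) :
    Integrable (fun ω => Y t k ω * Y t l ω) P :=
  (hY.memLp_two t k).integrable_mul (hY.memLp_two t l)

theorem IsIIDNoise.integral_mul (hY : IsIIDNoise P ν Y) (t : ℕ) (k l : Fin p) :
    ∫ ω, Y t k ω * Y t l ω ∂P = if k = l then 1 else 0 := by
  split_ifs with h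
  · subst h
    rw [← hY.unit_variance, ← hY.integral_comp t k (by fun_prop : Measurable fun x : ℝ => x ^ 2)]
    simp only [sq]
  · have hind : IndepFun (Y t k) (Y t l) P :=
      hY.indep.indepFun (i := (t, k)) (j := (t, l)) (by simpa using h)
    rw [hind.integral_fun_mul_eq_mul_integral (hY.aemeasurable t k).aestronglyMeasurable
      (hY.aemeasurable t l).aestronglyMeasurable, show (∫ ω, Y t k ω ∂P) = 0 from
        (hY.integral_comp t k measurable_id).trans hY.mean_zero, zero_mul]

theorem IsIIDNoise.integral_crossProd [IsProbabilityMeasure P] (hY : IsIIDNoise P ν Y) (B : Matrix (Fin p) (Fin p) ℝ)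
    (i j : Fin p) (t : ℕ) :
    ∫ ω, crossProd B i j (fun k => Y t k ω) ∂P = (B * Bᵀ) i j := by
  simp only [crossProd_eq_sum]
  rw [integral_finsetSum _ fun k _ => integrable_finsetSum _ fun l _ =>
    (hY.integrable_mul t k l).const_mul _, Matrix.mul_apply]
  refine Finset.sum_congr rfl fun k _ => ?_
  rw [integral_finsetSum _ fun l _ => (hY.integrable_mul t k l).const_mul _]
  simp [integral_const_mul, hY.integral_mul]

theorem IsIIDNoise.aemeasurable_crossProd (hY : IsIIDNoise P ν Y)
    (B : Matrix (Fin p) (Fin p) ℝ) (i j : Fin p) (t : ℕ) :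
    AEMeasurable (fun ω => crossProd B i j (fun k => Y t k ω)) P :=
  (measurable_crossProd B i j).comp_aemeasurable (aemeasurable_pi_lambda _ fun k =>
    hY.aemeasurable t k)

theorem IsIIDNoise.memLp_crossProd [IsProbabilityMeasure P] (hY : IsIIDNoise P ν Y)
    (B : Matrix (Fin p) (Fin p) ℝ) (i j : Fin p) (t : ℕ) :
    MemLp (fun ω => crossProd B i j (fun k => Y t k ω)) 2 P := by
  have hm := hY.aemeasurable_crossProd B i j t
  rw [memLp_two_iff_integrable_sq hm.aestronglyMeasurable]
  have hB : ∀ i' j', |B i' j'| ≤ ∑ i, ∑ j, |B i j| := fun i' j' =>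
    (Finset.single_le_sum (f := fun j => |B i' j|) (fun _ _ => abs_nonneg _)
      (Finset.mem_univ j')).trans
    (Finset.single_le_sum (f := fun i => ∑ j, |B i j|)
      (fun _ _ => Finset.sum_nonneg fun _ _ => abs_nonneg _) (Finset.mem_univ i'))
  refine ((integrable_finsetSum Finset.univ fun k _ => hY.integrable_pow_four t k).const_mul
    ((∑ i, ∑ j, |B i j|) ^ 4 * p ^ 3)).mono' (hm.pow_const 2).aestronglyMeasurable
    (ae_of_all _ fun ω => ?_)
  rw [Real.norm_eq_abs, abs_of_nonneg (sq_nonneg _)]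
  exact sq_crossProd_le hB i j _

theorem IsIIDNoise.variance_crossProd_le [IsProbabilityMeasure P] (hY : IsIIDNoise P ν Y)
    {B : Matrix (Fin p) (Fin p) ℝ} {a : ℝ} (hB : ∀ i j, |B i j| ≤ a) (i j : Fin p) (t : ℕ) :
    variance (fun ω => crossProd B i j (fun k => Y t k ω)) P ≤
      a ^ 4 * p ^ 4 * ∫ x, x ^ 4 ∂ν := by
  refine (variance_le_expectation_sq
    (hY.aemeasurable_crossProd B i j t).aestronglyMeasurable).trans ?_
  calc ∫ ω, ((fun ω => crossProd B i j (fun k => Y t k ω)) ^ 2) ω ∂P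
      ≤ ∫ ω, a ^ 4 * p ^ 3 * ∑ k, Y t k ω ^ 4 ∂P :=
        integral_mono ((memLp_two_iff_integrable_sq
          (hY.aemeasurable_crossProd B i j t).aestronglyMeasurable).mp
            (hY.memLp_crossProd B i j t))
          ((integrable_finsetSum _ fun k _ => hY.integrable_pow_four t k).const_mul _)
          fun ω => sq_crossProd_le hB i j _
    _ = _ := by
      rw [integral_const_mul, integral_finsetSum _ fun k _ => hY.integrable_pow_four t k]
      simp only [hY.integral_comp t _ (by fun_prop : Measurable fun x : ℝ => x ^ 4)]
      simp; ring

/-- Each cross product is a function of its own time block of the independent family, and distinct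
times give disjoint blocks. Pairwise independence is all that the variance of the sum needs. -/
theorem IsIIDNoise.indepFun_crossProd (hY : IsIIDNoise P ν Y)
    (B C : Matrix (Fin p) (Fin p) ℝ) (i j : Fin p) {s t : ℕ} (hst : s ≠ t) :
    IndepFun (fun ω => crossProd B i j (fun k => Y s k ω))
      (fun ω => crossProd C i j (fun k => Y t k ω)) P := by
  let S : ℕ → Finset (ℕ × Fin p) := fun r => {r} ×ˢ Finset.univ
  have hmem : ∀ r (k : Fin p), (r, k) ∈ S r := fun r k => by simp [S]
  have hdisj : Disjoint (S s) (S t) := by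
    rw [Finset.disjoint_left]
    rintro ⟨r, k⟩ h1 h2
    simp only [S, Finset.mem_product, Finset.mem_singleton] at h1 h2
    exact hst (h1.1.symm.trans h2.1)
  have h := hY.indep.indepFun_finset₀ (S s) (S t) hdisj fun q => hY.aemeasurable q.1 q.2
  have hφ : ∀ (D : Matrix (Fin p) (Fin p) ℝ) (r : ℕ),
      Measurable fun z : S r → ℝ => crossProd D i j fun k => z ⟨(r, k), hmem r k⟩ :=
    fun D r => (measurable_crossProd D i j).comp
      (measurable_pi_lambda _ fun k => measurable_pi_apply _)
  exact h.comp (hφ B s) (hφ C t)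

theorem weightedCov_obs_apply {Ω' : Type*} (A : ℝ → Matrix (Fin p) (Fin p) ℝ) (w : ℕ → ℝ)
    (Y : ℕ → Fin p → Ω' → ℝ) (T : ℕ) (ω : Ω') (i j : Fin p) : weightedCov w T (obs A Y T ω) i j =
      (T : ℝ)⁻¹ * ∑ t ∈ Finset.Icc 1 T,
        w t * crossProd (A ((t : ℝ) / T)) i j (fun k => Y t k ω) := by
  simp [weightedCov, Matrix.sum_apply, vecMulVec_apply, obs, crossProd]

/-- Chebyshev's inequality for the entries of a weighted covariance matrix. -/
theorem IsIIDNoise.measure_weightedCov_sub_le [IsProbabilityMeasure P] (hY : IsIIDNoise P ν Y)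
    {A : ℝ → Matrix (Fin p) (Fin p) ℝ} {a : ℝ}
    (hA : ∀ v ∈ Set.Ioc (0 : ℝ) 1, ∀ i j, |A v i j| ≤ a) (w : ℕ → ℝ) {T : ℕ} (hT : 0 < T)
    (i j : Fin p) {m η : ℝ} (hη : 0 < η)
    (hbias : |(T : ℝ)⁻¹ * ∑ t ∈ Finset.Icc 1 T,
      w t * (A ((t : ℝ) / T) * (A ((t : ℝ) / T))ᵀ) i j - m| ≤ η) :
    P {ω | 2 * η < |weightedCov w T (obs A Y T ω) i j - m|} ≤
      ENNReal.ofReal ((a ^ 4 * p ^ 4 * ∫ x, x ^ 4 ∂ν) *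
        ((T : ℝ)⁻¹ ^ 2 * ∑ t ∈ Finset.Icc 1 T, w t ^ 2) / η ^ 2) := by
  have hT' : (0 : ℝ) < T := by exact_mod_cast hT
  let Z : ℕ → Ω → ℝ := fun t ω =>
    w t * crossProd (A ((t : ℝ) / T)) i j (fun k => Y t k ω)
  have hZ2 : ∀ t, MemLp (Z t) 2 P := fun t => (hY.memLp_crossProd _ i j t).const_mul _
  set Q : Ω → ℝ := fun ω => weightedCov w T (obs A Y T ω) i j with hQ
  have hQZ : Q = fun ω => (T : ℝ)⁻¹ * (∑ t ∈ Finset.Icc 1 T, Z t) ω := by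
    funext ω
    rw [hQ, Finset.sum_apply]
    exact weightedCov_obs_apply A w Y T ω i j
  have hsum2 : MemLp (∑ t ∈ Finset.Icc 1 T, Z t) 2 P := memLp_finsetSum' _ fun t _ => hZ2 t
  have hQ2 : MemLp Q 2 P := by rw [hQZ]; exact hsum2.const_mul _
  have hmean : ∫ ω, Q ω ∂P = (T : ℝ)⁻¹ * ∑ t ∈ Finset.Icc 1 T,
      w t * (A ((t : ℝ) / T) * (A ((t : ℝ) / T))ᵀ) i j := by
    rw [hQZ, integral_const_mul]
    simp only [Finset.sum_apply]
    rw [integral_finsetSum _ fun t _ => (hZ2 t).integrable (by norm_num)]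
    simp only [Z, integral_const_mul, hY.integral_crossProd]
  have hvar : variance Q P ≤ (a ^ 4 * p ^ 4 * ∫ x, x ^ 4 ∂ν) *
        ((T : ℝ)⁻¹ ^ 2 * ∑ t ∈ Finset.Icc 1 T, w t ^ 2) := by
    rw [hQZ, variance_const_mul, IndepFun.variance_sum (fun t _ => hZ2 t)]
    · rw [mul_left_comm]
      refine mul_le_mul_of_nonneg_left ?_ (by positivity)
      rw [Finset.mul_sum]
      refine Finset.sum_le_sum fun t ht => ?_
      have ht' := Finset.mem_Icc.mp ht
      have hmem : (t : ℝ) / T ∈ Set.Ioc (0 : ℝ) 1 := by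
        have h1 : (0 : ℝ) < t := by exact_mod_cast ht'.1
        exact ⟨by positivity, (div_le_one hT').mpr (by exact_mod_cast ht'.2)⟩
      simp only [Z]
      rw [variance_const_mul, mul_comm]
      exact mul_le_mul_of_nonneg_right (hY.variance_crossProd_le (hA _ hmem) i j t)
        (sq_nonneg _)
    · intro s _ t _ hst
      exact (hY.indepFun_crossProd _ _ i j hst).comp (measurable_const_mul _)
        (measurable_const_mul _)
  -- The bias uses up at most `η` of the deviation `2η`, so the distance to the mean is at least
  -- `η`.
  refine (measure_mono fun ω hω => ?_).trans ((meas_ge_le_variance_div_sq hQ2 hη).trans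
    (ENNReal.ofReal_le_ofReal (by gcongr)))
  have h1 : 2 * η < |Q ω - m| := hω
  show η ≤ |Q ω - ∫ x, Q x ∂P|
  rw [hmean]
  have h2 := abs_sub_le (Q ω) ((T : ℝ)⁻¹ * ∑ t ∈ Finset.Icc 1 T,
      w t * (A ((t : ℝ) / T) * (A ((t : ℝ) / T))ᵀ) i j) m
  linarith

end

/-! ### Rate of the two covariance estimators -/

section

variable {p : ℕ}

/-- Points of `(0,1)` are within distance `1` of `1/2`. The value at `1` is bounded separately: it
is a design point but lies outside the Lipschitz interval. -/
theorem exists_entry_bounds {A : ℝ → Matrix (Fin p) (Fin p) ℝ}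
    (hA : ∀ i j, ∃ L, LipschitzOnWith L (fun v => A v i j) (Set.Ioo 0 1)) :
    ∃ a ≥ 0, ∃ L ≥ 0, (∀ v ∈ Set.Ioc (0 : ℝ) 1, ∀ i j, |A v i j| ≤ a) ∧
      ∀ v ∈ Set.Ioo (0 : ℝ) 1, ∀ w ∈ Set.Ioo (0 : ℝ) 1, ∀ i j,
        |A v i j - A w i j| ≤ L * |v - w| := by
  choose L hL using hA
  have hle : ∀ f : Fin p → Fin p → ℝ, (∀ i j, 0 ≤ f i j) → ∀ i j, f i j ≤ ∑ i, ∑ j, f i j :=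
    fun f hf i j =>
      (Finset.single_le_sum (f := fun j => f i j) (fun j _ => hf i j) (Finset.mem_univ j)).trans
        (Finset.single_le_sum (f := fun i => ∑ j, f i j)
          (fun i _ => Finset.sum_nonneg fun j _ => hf i j) (Finset.mem_univ i))
  have hlip : ∀ i j, ∀ v ∈ Set.Ioo (0 : ℝ) 1, ∀ w ∈ Set.Ioo (0 : ℝ) 1,
      |A v i j - A w i j| ≤ L i j * |v - w| := fun i j v hv w hw => by
    have := (hL i j).dist_le_mul v hv w hw
    rwa [Real.dist_eq, Real.dist_eq] at this
  refine ⟨∑ i, ∑ j, (|A (1 / 2) i j| + L i j + |A 1 i j|), by positivity,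
    ∑ i, ∑ j, (L i j : ℝ), by positivity, fun v hv i j => ?_, fun v hv w hw i j => ?_⟩
  · refine le_trans ?_ (hle (fun i j => |A (1 / 2) i j| + L i j + |A 1 i j|)
      (fun i j => by positivity) i j)
    rcases eq_or_lt_of_le hv.2 with h1 | h1
    · rw [h1]
      have : 0 ≤ |A (1 / 2) i j| + L i j := by positivity
      linarith
    · have h2 := hlip i j v ⟨hv.1, h1⟩ (1 / 2) (by constructor <;> norm_num)
      have h3 : |v - 1 / 2| ≤ 1 := abs_le.mpr ⟨by linarith [hv.1], by linarith⟩
      have h4 : L i j * |v - 1 / 2| ≤ L i j * 1 := mul_le_mul_of_nonneg_left h3 (L i j).2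
      have h5 := abs_sub_abs_le_abs_sub (A v i j) (A (1 / 2) i j)
      have h6 := abs_nonneg (A 1 i j)
      linarith
  · refine (hlip i j v hv w hw).trans (mul_le_mul_of_nonneg_right ?_ (abs_nonneg _))
    exact hle (fun i j => (L i j : ℝ)) (fun i j => (L i j).2) i j

theorem abs_mul_transpose_le {B : Matrix (Fin p) (Fin p) ℝ} {a : ℝ} (ha : 0 ≤ a)
    (hB : ∀ i j, |B i j| ≤ a) (i j : Fin p) : |(B * Bᵀ) i j| ≤ p * a ^ 2 := by
  rw [Matrix.mul_apply]
  refine (Finset.abs_sum_le_sum_abs _ _).trans ?_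
  calc ∑ k, |B i k * Bᵀ k j| ≤ ∑ _k : Fin p, a ^ 2 := Finset.sum_le_sum fun k _ => by
        rw [abs_mul, transpose_apply, sq]
        have := hB i k; have := hB j k; gcongr
    _ = p * a ^ 2 := by simp

theorem abs_mul_transpose_sub_le {B C : Matrix (Fin p) (Fin p) ℝ} {a d : ℝ} (ha : 0 ≤ a)
    (hB : ∀ i j, |B i j| ≤ a) (hC : ∀ i j, |C i j| ≤ a) (hd : ∀ i j, |B i j - C i j| ≤ d)
    (i j : Fin p) : |(B * Bᵀ) i j - (C * Cᵀ) i j| ≤ 2 * p * a * d := by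
  rw [Matrix.mul_apply, Matrix.mul_apply, ← Finset.sum_sub_distrib]
  refine (Finset.abs_sum_le_sum_abs _ _).trans ?_
  calc ∑ k, |B i k * Bᵀ k j - C i k * Cᵀ k j| ≤ ∑ _k : Fin p, (2 * a * d) :=
        Finset.sum_le_sum fun k _ => by
          have e : B i k * Bᵀ k j - C i k * Cᵀ k j =
              B i k * (B j k - C j k) + (B i k - C i k) * C j k := by
            simp only [transpose_apply]; ring
          rw [e]
          refine (abs_add_le _ _).trans ?_
          rw [abs_mul, abs_mul]
          have h1 : |B i k| * |B j k - C j k| ≤ a * d :=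
            mul_le_mul (hB i k) (hd j k) (abs_nonneg _) ha
          have h2 : |B i k - C i k| * |C j k| ≤ d * a :=
            mul_le_mul (hd i k) (hC j k) (abs_nonneg _) ((abs_nonneg _).trans (hd i k))
          linarith
    _ = _ := by simp; ring

/-- Writing `w = (B⁻¹)ᵀ (Bᵀ w)` bounds `|w|²` by the squared Frobenius norm of the inverse times the
form; adding `1` avoids division by zero. -/
theorem exists_pos_mul_dotProduct_le {B : Matrix (Fin p) (Fin p) ℝ} (hB : IsUnit B) :
    ∃ a > 0, ∀ w, a * (w ⬝ᵥ w) ≤ w ⬝ᵥ ((B * Bᵀ) *ᵥ w) := by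
  have hdet := (isUnit_iff_isUnit_det B).mp hB
  set F := ∑ i, ∑ j, (B⁻¹)ᵀ i j ^ 2 with hF
  have hF0 : 0 ≤ F := by positivity
  refine ⟨(F + 1)⁻¹, by positivity, fun w => ?_⟩
  have h1 : w = (B⁻¹)ᵀ *ᵥ (Bᵀ *ᵥ w) := by
    rw [mulVec_mulVec, ← transpose_mul, mul_nonsing_inv B hdet, transpose_one, one_mulVec]
  have h2 : w ⬝ᵥ w ≤ F * ((Bᵀ *ᵥ w) ⬝ᵥ (Bᵀ *ᵥ w)) := by
    conv_lhs => rw [h1]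
    exact mulVec_dotProduct_self_le _ _
  have h3 : w ⬝ᵥ ((B * Bᵀ) *ᵥ w) = (Bᵀ *ᵥ w) ⬝ᵥ (Bᵀ *ᵥ w) := by
    rw [dotProduct_transpose_mulVec, transpose_transpose, mulVec_mulVec]
  rw [h3, inv_mul_le_iff₀ (by positivity)]
  linarith [dotProduct_self_nonneg' (Bᵀ *ᵥ w)]

theorem popM_isHermitian (A : ℝ → Matrix (Fin p) (Fin p) ℝ) (u : ℝ) :
    (popM A u).IsHermitian := by
  have hsymm : ∀ (B : Matrix (Fin p) (Fin p) ℝ) i j, (B * Bᵀ) i j = (B * Bᵀ) j i := by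
    intro B i j
    simp only [Matrix.mul_apply, transpose_apply, mul_comm]
  refine IsHermitian.ext fun i j => ?_
  simp only [popM, Matrix.sub_apply, of_apply, star_trivial, hsymm _ j i]

/-- Both covariance estimators converge at the rate `(T h)^(-1/2)`. -/
theorem exists_measure_estimation_error_le {Ω : Type*} [MeasurableSpace Ω] {P : Measure Ω}
    [IsProbabilityMeasure P] {ν : Measure ℝ} {Y : ℕ → Fin p → Ω → ℝ} (hY : IsIIDNoise P ν Y)
    {A : ℝ → Matrix (Fin p) (Fin p) ℝ}
    (hA : ∀ i j, ∃ L, LipschitzOnWith L (fun v => A v i j) (Set.Ioo 0 1))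
    {u : ℝ} (hu : u ∈ Set.Ioo (0 : ℝ) 1) {K : ℝ → ℝ} (hK : IsKernel K)
    {h : ℕ → ℝ} (hpos : ∀ T, 0 < h T) (h0 : Tendsto h atTop (𝓝 0))
    (hTh : Tendsto (fun T : ℕ => (T : ℝ) * h T) atTop atTop)
    (hTh3 : Tendsto (fun T : ℕ => (T : ℝ) * h T ^ 3) atTop (𝓝 0)) :
    ∃ D R₀ : ℝ, ∀ R ≥ R₀, ∀ᶠ T : ℕ in atTop,
      P {ω | ¬ ((∀ i j, |(estA2 K (h T) u T (obs A Y T ω) - A u * (A u)ᵀ) i j| ≤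
          4 * R * (√(T * h T))⁻¹) ∧
        ∀ i j, |(estM K (h T) u T (obs A Y T ω) - popM A u) i j| ≤
          4 * R * (√(T * h T))⁻¹)} ≤ ENNReal.ofReal (D / R ^ 2) := by
  obtain ⟨a, ha, L, hL0, hab, hLip⟩ := exists_entry_bounds hA
  set g : Fin p → Fin p → ℝ → ℝ := fun i j v => (A v * (A v)ᵀ) i j with hg
  have hgG : ∀ i j, ∀ v ∈ Set.Ioc (0 : ℝ) 1, |g i j v| ≤ p * a ^ 2 := fun i j v hv =>
    abs_mul_transpose_le ha (hab v hv) i j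
  have hgL : ∀ i j, ∀ v ∈ Set.Ioo (0 : ℝ) 1, ∀ w ∈ Set.Ioo (0 : ℝ) 1,
      |g i j v - g i j w| ≤ 2 * p * a * L * |v - w| := fun i j v hv w hw => by
    have := abs_mul_transpose_sub_le ha (hab v ⟨hv.1, hv.2.le⟩) (hab w ⟨hw.1, hw.2.le⟩)
      (hLip v hv w hw) i j
    rwa [← mul_assoc] at this
  have hL'0 : 0 ≤ 2 * p * a * L := by positivity
  choose C1 hC10 hC1 using fun i j => hK.exists_bias_bound hu (hgG i j) hL'0 (hgL i j)
  obtain ⟨C2, hC20, hC2⟩ := hK.exists_sum_sq_bound u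
  set Q := ∑ i, ∑ j, C1 i j with hQ
  have hC1Q : ∀ i j, C1 i j ≤ Q := fun i j =>
    (Finset.single_le_sum (f := fun j => C1 i j) (fun j _ => hC10 i j) (Finset.mem_univ j)).trans
      (Finset.single_le_sum (f := fun i => ∑ j, C1 i j)
        (fun i _ => Finset.sum_nonneg fun j _ => hC10 i j) (Finset.mem_univ i))
  have hQ0 : 0 ≤ Q := Finset.sum_nonneg fun i _ => Finset.sum_nonneg fun j _ => hC10 i j
  set C3 := 2 * p * a * L + 2 * (p * a ^ 2) with hC3
  have hC30 : 0 ≤ C3 := by positivity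
  set m4 := a ^ 4 * p ^ 4 * ∫ x, x ^ 4 ∂ν with hm4
  have hm40 : 0 ≤ m4 := mul_nonneg (by positivity) (integral_nonneg fun x => by positivity)
  -- The factor `p²` counts entries, and the two summands are the variance constants of the kernel
  -- and sample covariances. The threshold makes both biases at most `R ρ`, and `1` ensures `R > 0`.
  refine ⟨p ^ 2 * (m4 * (2 * C2) + m4), 3 * Q + C3 + 1, fun R hR => ?_⟩
  have hR0 : 0 < R := by linarith
  filter_upwards [hTh.eventually_ge_atTop 1, h0.eventually (ge_mem_nhds one_pos),
    hTh3.eventually (ge_mem_nhds one_pos), eventually_gt_atTop 0] with T hT1 hh1 hT3 hT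
  have hT' : (0 : ℝ) < T := by exact_mod_cast hT
  have hh := hpos T
  have hs0 : 0 < T * h T := by positivity
  set ρ := (√(T * h T))⁻¹ with hρ
  have hρ0 : 0 < ρ := by positivity
  have hρsq : ρ ^ 2 = (T * h T)⁻¹ := by rw [hρ, inv_pow, Real.sq_sqrt hs0.le]
  have hρ1 : ρ ≤ 1 := inv_le_one_of_one_le₀ (Real.one_le_sqrt.mpr hT1)
  have hinv : (T * h T)⁻¹ ≤ ρ := by rw [← hρsq]; nlinarith
  have hTinv2 : (T : ℝ)⁻¹ ≤ (T * h T)⁻¹ := by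
    apply inv_anti₀ hs0
    nlinarith
  have hTinv : (T : ℝ)⁻¹ ≤ ρ := hTinv2.trans hinv
  -- This is `T h³ ≤ 1` rewritten: the smoothing bias does not exceed the stochastic rate.
  have hhρ : h T ≤ ρ := by
    rw [hρ, le_inv_comm₀ hh (by positivity), Real.sqrt_le_left (by positivity), inv_pow,
      le_inv_comm₀ hs0 (by positivity), ← one_div, le_div_iff₀ hs0]
    linarith
  have hinv0 : 0 ≤ (T * h T)⁻¹ := by positivity
  -- the kernel estimator
  have hA2 : ∀ i j, P {ω | 2 * (R * ρ) <
      |estA2 K (h T) u T (obs A Y T ω) i j - g i j u|} ≤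
      ENNReal.ofReal (m4 * (2 * C2) / R ^ 2) := by
    intro i j
    have h1 := hC1 i j (h T) T hh hT
    refine (hY.measure_weightedCov_sub_le hab _ hT i j (mul_pos hR0 hρ0) (h1.trans ?_)).trans
      (ENNReal.ofReal_le_ofReal ?_)
    · calc C1 i j * (h T + (T : ℝ)⁻¹ + (T * h T)⁻¹) ≤ Q * (ρ + ρ + ρ) := by
            have := hC1Q i j; gcongr
        _ = 3 * Q * ρ := by ring
        _ ≤ R * ρ := by gcongr; linarith
    · have h2 := hC2 (h T) T hh hT
      rw [mul_pow, div_le_div_iff₀ (by positivity) (by positivity)]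
      have h3 : (T * h T)⁻¹ * (1 + (T * h T)⁻¹) ≤ 2 * ρ ^ 2 := by
        rw [hρsq]; nlinarith [hinv.trans hρ1]
      have h4 := h2.trans (mul_le_mul_of_nonneg_left h3 hC20)
      calc _ ≤ m4 * (C2 * (2 * ρ ^ 2)) * R ^ 2 := by gcongr
        _ = _ := by ring
  -- the sample covariance
  have hcov : ∀ i j, P {ω | 2 * (R * ρ) <
      |weightedCov (fun _ => 1) T (obs A Y T ω) i j - ∫ v in Set.Ioo (0 : ℝ) 1, g i j v|} ≤
      ENNReal.ofReal (m4 / R ^ 2) := by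
    intro i j
    -- The constant kernel `1` has variation zero, so only the Lipschitz and endpoint terms remain,
    -- which add up to `C3`.
    have h1 := abs_riemann_sum_sub_integral_le (k := fun _ => 1) (W := fun _ => 0) (V := 0)
      (κ := 1) (by simp) (by simp) (by simp) (by simp) (hgG i j) hL'0 (hgL i j) hT
    simp only [one_mul, zero_mul, zero_add, mul_one] at h1
    refine (hY.measure_weightedCov_sub_le hab (fun _ => 1) hT i j (mul_pos hR0 hρ0)
      (m := ∫ v in Set.Ioo (0 : ℝ) 1, g i j v) ?_).trans (ENNReal.ofReal_le_ofReal ?_)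
    · simp only [one_mul]
      refine h1.trans ?_
      have e : (∫ _v in Set.Ioo (0 : ℝ) 1, |(1 : ℝ)|) = 1 := by simp
      rw [e, mul_one, div_eq_mul_inv]
      calc C3 * (T : ℝ)⁻¹ ≤ C3 * ρ := by gcongr
        _ ≤ R * ρ := by gcongr; linarith
    · have h3 : (T : ℝ)⁻¹ ^ 2 * ∑ _t ∈ Finset.Icc 1 T, (1 : ℝ) ^ 2 = (T : ℝ)⁻¹ := by
        simp; field_simp
      rw [h3, mul_pow, div_le_div_iff₀ (by positivity) (by positivity), hρsq]
      calc m4 * (T : ℝ)⁻¹ * R ^ 2 ≤ m4 * (T * h T)⁻¹ * R ^ 2 := by gcongr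
        _ = _ := by ring
  -- Each covariance error is at most `2 R ρ` off the union; the error for `M` is a difference of
  -- two of them, hence `4 R ρ`.
  calc P _ ≤ P (⋃ q : Fin p × Fin p,
        ({ω | 2 * (R * ρ) < |estA2 K (h T) u T (obs A Y T ω) q.1 q.2 - g q.1 q.2 u|} ∪
        {ω | 2 * (R * ρ) < |weightedCov (fun _ => 1) T (obs A Y T ω) q.1 q.2 -
          ∫ v in Set.Ioo (0 : ℝ) 1, g q.1 q.2 v|})) := by
        refine measure_mono fun ω hω => ?_
        by_contra hno
        simp only [Set.mem_iUnion, Set.mem_union, Set.mem_ofPred_eq, not_exists, not_or, not_lt,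
          Prod.forall] at hno
        refine hω ⟨fun i j => ?_, fun i j => ?_⟩
        · have h1 := (hno i j).1
          rw [Matrix.sub_apply]
          refine h1.trans ?_
          have := mul_pos hR0 hρ0
          linarith
        · have h1 := (hno i j).1
          have h2 := (hno i j).2
          have e : (estM K (h T) u T (obs A Y T ω) - popM A u) i j =
              (estA2 K (h T) u T (obs A Y T ω) i j - g i j u) -
              (weightedCov (fun _ => 1) T (obs A Y T ω) i j -
                ∫ v in Set.Ioo (0 : ℝ) 1, g i j v) := by
            simp only [estM, popM, Matrix.sub_apply, of_apply, hg]; ring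
          rw [e]
          refine (abs_sub _ _).trans ?_
          linarith
    _ ≤ ∑ q : Fin p × Fin p, P
        ({ω | 2 * (R * ρ) < |estA2 K (h T) u T (obs A Y T ω) q.1 q.2 - g q.1 q.2 u|} ∪
        {ω | 2 * (R * ρ) < |weightedCov (fun _ => 1) T (obs A Y T ω) q.1 q.2 -
          ∫ v in Set.Ioo (0 : ℝ) 1, g q.1 q.2 v|}) := measure_iUnion_fintype_le _ _
    _ ≤ ∑ _q : Fin p × Fin p, ENNReal.ofReal ((m4 * (2 * C2) + m4) / R ^ 2) := by
        refine Finset.sum_le_sum fun q _ => (measure_union_le _ _).trans ?_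
        rw [add_div, ENNReal.ofReal_add (by positivity) (by positivity)]
        exact add_le_add (hA2 q.1 q.2) (hcov q.1 q.2)
    _ = _ := by
        rw [Finset.sum_const, Finset.card_univ, Fintype.card_prod, Fintype.card_fin, nsmul_eq_mul,
          ← ENNReal.ofReal_natCast, ← ENNReal.ofReal_mul (by positivity)]
        congr 1
        push_cast
        ring

end

end VCModel

end

/-! ### Consistency -/

theorem theorem4p1
    {p : ℕ} {Ω : Type*} [MeasurableSpace Ω] (P : Measure Ω) [IsProbabilityMeasure P]
    -- the noise
    (ν : Measure ℝ) [IsProbabilityMeasure ν] (Y : ℕ → Fin p → Ω → ℝ)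
    (hY : VCModel.IsIIDNoise P ν Y) (hμ4 : 0 < VCModel.mu4 ν)
    -- the coefficient matrix
    (A : ℝ → Matrix (Fin p) (Fin p) ℝ)
    (hA : ∀ i j, ∃ L, LipschitzOnWith L (fun v => A v i j) (Set.Ioo 0 1))
    (u : ℝ) (hu : u ∈ Set.Ioo (0 : ℝ) 1) (hAu : IsUnit (A u))
    -- the kernel and the bandwidths
    (K : ℝ → ℝ) (hK : VCModel.IsKernel K)
    (h : ℕ → ℝ) (hpos : ∀ T, 0 < h T) (h0 : Tendsto h atTop (𝓝 0))
    (hTh : Tendsto (fun T : ℕ => (T : ℝ) * h T) atTop atTop)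
    (hTh3 : Tendsto (fun T : ℕ => (T : ℝ) * h T ^ 3) atTop (𝓝 0))
    -- the significance levels
    (α : ℕ → ℝ) (hα : ∀ T, α T ∈ Set.Ioo (0 : ℝ) 1) (hα0 : Tendsto α atTop (𝓝 0))
    (hαT : Tendsto (fun T : ℕ => (-Real.log (α T)) / ((T : ℝ) * h T)) atTop (𝓝 0)) :
    TendstoInMeasure P
      (fun (T : ℕ) (ω : Ω) =>
        (VCModel.dHat K (h T) (VCModel.mu4 ν) (α T) u T (VCModel.obs A Y T ω) : ℝ))
      atTop
      (fun _ => (VCModel.pseudoNullity (VCModel.popM A u) : ℝ)) := by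
  obtain ⟨a₀, ha₀, hS⟩ := VCModel.exists_pos_mul_dotProduct_le hAu
  obtain ⟨ε, hε, c, hc, C, hC, hdet⟩ :=
    VCModel.exists_dHat_eq_pseudoNullity ha₀ hS (VCModel.popM_isHermitian A u)
  obtain ⟨D, R₀, hprob⟩ := VCModel.exists_measure_estimation_error_le hY hA hu hK hpos h0 hTh hTh3
  have hk2 : 0 < (∫ v, K v ^ 2) * VCModel.mu4 ν := mul_pos hK.integral_sq_pos hμ4
  set b := (∫ v, K v ^ 2) * VCModel.mu4 ν with hb
  intro e he
  rw [ENNReal.tendsto_nhds_zero]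
  intro η hη
  have hD : Tendsto (fun R : ℝ => ENNReal.ofReal (D / R ^ 2)) atTop (𝓝 0) := by
    rw [← ENNReal.ofReal_zero]
    exact ENNReal.tendsto_ofReal ((tendsto_pow_atTop two_ne_zero).const_div_atTop D)
  -- `R` is fixed before `T`: the exceptional probability is at most `η`, while the error bound `4R
  -- (Th)^(-1/2)` still tends to zero.
  obtain ⟨R, hRη, hR₀, hR0⟩ := ((hD.eventually (ge_mem_nhds hη)).and
    ((eventually_ge_atTop R₀).and (eventually_ge_atTop 0))).exists
  have hδ : Tendsto (fun T : ℕ => 4 * R * (√(T * h T))⁻¹) atTop (𝓝 (4 * R * 0)) :=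
    (tendsto_inv_atTop_zero.comp (Real.tendsto_sqrt_atTop.comp hTh)).const_mul _
  rw [mul_zero] at hδ
  have hdf : ∀ r, 1 ≤ r → 0 < r * (r + 1) / 2 := fun r hr =>
    Nat.div_pos (by nlinarith) two_pos
  -- The left side bounds the statistic at the true `r` and is free of `T`, since the factor `Th`
  -- cancels against the squared error.
  have hlow : ∀ᶠ T in atTop, ∀ r ∈ Finset.Icc 1 p,
      C * (4 * R) ^ 2 / b ≤ VCModel.chiSqCrit (r * (r + 1) / 2) (α T) := by
    rw [Filter.eventually_all_finset]
    intro r hr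
    exact (VCModel.tendsto_chiSqCrit_atTop (hdf r (Finset.mem_Icc.mp hr).1) hα
      hα0).eventually_ge_atTop _
  have hupp : ∀ᶠ T : ℕ in atTop, ∀ r ∈ Finset.Icc 1 p,
      VCModel.chiSqCrit (r * (r + 1) / 2) (α T) < c / b * (T * h T) := by
    rw [Filter.eventually_all_finset]
    intro r hr
    exact VCModel.eventually_chiSqCrit_lt (hdf r (Finset.mem_Icc.mp hr).1) hα hTh hαT (by positivity)
  filter_upwards [hprob R hR₀, hδ.eventually (ge_mem_nhds hε), hlow, hupp,
    hTh.eventually_gt_atTop 0] with T hPT hδT hlowT huppT hThT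
  refine (measure_mono fun ω hω => ?_).trans (hPT.trans hRη)
  rintro ⟨hclose1, hclose2⟩
  have hρ : (√(T * h T))⁻¹ ^ 2 = (T * h T)⁻¹ := by rw [inv_pow, Real.sq_sqrt hThT.le]
  have heq := hdet K (h T) (VCModel.mu4 ν) (α T) u T (VCModel.obs A Y T ω) _ (by positivity) hδT
    hclose1 hclose2 (by positivity)
    (fun r h1 h2 => by
      refine le_trans (le_of_eq ?_) (hlowT r (Finset.mem_Icc.mpr ⟨h1, h2⟩))
      rw [mul_pow, hρ, ← hb]
      symm
      calc C * (4 * R) ^ 2 / b = (T * h T) * (T * h T)⁻¹ * (C * (4 * R) ^ 2 / b) := by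
            rw [mul_inv_cancel₀ hThT.ne', one_mul]
        _ = _ := by ring)
    (fun r h1 h2 => by
      refine (huppT r (Finset.mem_Icc.mpr ⟨h1, h2⟩)).trans_eq ?_
      ring)
  -- On the good event the estimate equals its target, so a distance of at least `e > 0` is
  -- impossible.
  have hω' : e ≤ edist (VCModel.dHat K (h T) (VCModel.mu4 ν) (α T) u T (VCModel.obs A Y T ω) : ℝ)
    (VCModel.pseudoNullity (VCModel.popM A u) : ℝ) := hω
  rw [heq, edist_self] at hω'
  exact absurd he (not_lt.mpr hω')
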